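/- **Theorem 5 (monotonicity of $\Upsilon_K$).** *Channel.* Fix a law of complex fading coefficients that has no atoms, is bounded away from $0$ and $\infty$, and satisfies $\mathbb E|h|^2=1$. For every user index $p$ and block length $n$ fix a law of an a.s. invertible random complex $n\times n$ matrix $\mathbf F_p$ (deterministic matrices allowed), with $\frac1n\operatorname{tr}(\mathbf F_p\mathbf F_p^{\mathrm H})\to1$ in probability as $n\to\infty$. In a block of $n$ slots the $K$-user interference channel is $$Y^{[p]}=\sum_{q\ne p}\mathbf H^{[pq]}X^{[q]}+\mathbf F_p\mathbf H^{[pp]}X^{[p]}+Z^{[p]},\qquad p=1,\dots,K,$$ where $\mathbf H^{[pq]}=\operatorname{diag}(h^{[pq]}_1,\dots,h^{[pq]}_n)$, all $h^{[pq]}_j$ are i.i.d. with the given law, the $\mathbf F_p$ are independent with the given laws, the noise $Z^{[p]}$ is i.i.d. circularly symmetric complex Gaussian of variance $1$, and coefficients, matrices and noise are independent. The $(K-1)$-user channel is the one with the same laws and the users $1,\dots,K-1$. *Channel state information (CSI).* A CSI pattern gives, for each $n$, sets $U^{[pq]}\subseteq\{1,\dots,n\}$: all transmitters and receivers know $h^{[pq]}_j$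 (for the whole block) for $j\notin U^{[pq]}$, and not for $j\in U^{[pq]}$. Receiver $p$ moreover knows $\mathbf F_p\mathbf H^{[pp]}$. The pattern has perfect-CSI fraction $\upsilon$ if $1-\frac1n\bigl|\bigcup_{p\neq q}U^{[pq]}\bigr|\to\upsilon$ as $n\to\infty$. *Degrees of freedom (DoF).* Let $\mathcal C(\rho)$ be the capacity region (closure of the achievable rate tuples, in bits per slot, with vanishing average error probability) under total transmit power $\rho$. The DoF region consists of all $d\in\mathbb R_{\ge0}^K$ such that $\sum_q w_qd_q\le\limsup_{\rho\to\infty}\sup_{R\in\mathcal C(\rho)}\frac{\sum_q w_qR_q}{\log_2\rho}$ for all $w\in\mathbb R_{\ge0}^K$. The maximum DoF is achieved if the region contains some $d$ with $\sum_q d_q=K/2$. *Statement.* Let $\Upsilon_K$ be the minimum (infimum; $+\infty$ if there is none) of the $\upsilon\in[0,1]$ such that the maximum DoF $K/2$ of the $K$-user channel is achieved under every CSI pattern with perfect-CSI fraction $\upsilon$. Then for every $K\ge3$, $$\Upsilon_K\ \ge\ \Upsilon_{K-1}.$$ -/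

import Mathlib

open MeasureTheory ProbabilityTheory Filter Topology

noncomputable section

namespace InterferenceChannel

/-- Complex matrices carry the product (Borel) sigma-algebra of their entries. -/
instance matrixMeasurableSpace (n : ℕ) : MeasurableSpace (Matrix (Fin n) (Fin n) ℂ) :=
  inferInstanceAs (MeasurableSpace (Fin n → Fin n → ℂ))

/-- The statistical description of the links of an interference channel, for any number of users.
`fading` is the common law of the i.i.d. coefficients `h_j^{[pq]}`; `direct p n` is the law of the
`n × n` matrix `F_p` (memory, permutation, ...) that acts on the direct link of user `p` over a
block of `n` time slots (a Dirac mass if `F_p` is deterministic). -/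
structure ChannelLaw where
  fading : Measure ℂ
  fading_prob : IsProbabilityMeasure fading
  /-- the coefficients are drawn from a continuous distribution -/
  fading_noAtoms : NullSingletonClass fading
  /-- the coefficients are bounded away from zero and from infinity -/
  fading_bounded : ∃ a b : ℝ, 0 < a ∧ ∀ᵐ h ∂fading, a ≤ ‖h‖ ∧ ‖h‖ ≤ b
  /-- normalization of the mean power gain of a coefficient -/
  fading_secondMoment : ∫ h, ‖h‖ ^ 2 ∂fading = 1
  direct : ℕ → (n : ℕ) → Measure (Matrix (Fin n) (Fin n) ℂ)
  direct_prob : ∀ p n, IsProbabilityMeasure (direct p n)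
  direct_fullRank : ∀ p n, ∀ᵐ F ∂(direct p n), IsUnit F.det
  /-- `tr (F_p F_pᴴ) / n → 1` (in probability) as the block length `n` tends to infinity -/
  direct_trace : ∀ p, ∀ ε : ℝ, 0 < ε →
    Tendsto (fun n : ℕ => direct p n {F | ε ≤ |(F * F.conjTranspose).trace.re / n - 1|})
      atTop (𝓝 0)

attribute [instance] ChannelLaw.fading_prob ChannelLaw.direct_prob

/-- The law of a circularly symmetric complex Gaussian variable of mean `0` and variance `1`. -/
def noiseLaw : Measure ℂ :=
  ((gaussianReal 0 (1 / 2)).prod (gaussianReal 0 (1 / 2))).map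
    (fun z : ℝ × ℝ => (⟨z.1, z.2⟩ : ℂ))

/-- The fading coefficients over a block: `h p q j` is the coefficient from transmitter `q` to
receiver `p` in slot `j`. -/
abbrev Fading (K n : ℕ) : Type := Fin K → Fin K → Fin n → ℂ

/-- All the randomness of the channel over a block: the fading coefficients, the matrices `F_p`,
and the additive noise at the receivers. -/
abbrev ChannelState (K n : ℕ) : Type :=
  Fading K n × (Fin K → Matrix (Fin n) (Fin n) ℂ) × (Fin K → Fin n → ℂ)

/-- The joint law of the channel state of the `K`-user channel: everything is independent. -/
def ChannelLaw.stateLaw (L : ChannelLaw) (K n : ℕ) : Measure (ChannelState K n) :=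
  (Measure.pi fun _ : Fin K => Measure.pi fun _ : Fin K => Measure.pi fun _ : Fin n =>
      L.fading).prod
    ((Measure.pi fun p : Fin K => L.direct p n).prod
      (Measure.pi fun _ : Fin K => Measure.pi fun _ : Fin n => noiseLaw))

/-- A pattern of channel state information: in a block of `n` slots, `U n p q` is the set of the
slots in which the coefficient from transmitter `q` to receiver `p` is unknown. -/
abbrev CSIPattern (K : ℕ) : Type := (n : ℕ) → Fin K → Fin K → Finset (Fin n)

/-- The fraction `1 - |⋃_{p ≠ q} U^{[pq]}| / n` of the slots of a block in which all the cross
coefficients are known. -/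
def perfectFraction {K : ℕ} (U : CSIPattern K) (n : ℕ) : ℝ :=
  1 - ((Finset.univ.filter fun j : Fin n => ∃ p q : Fin K, p ≠ q ∧ j ∈ U n p q).card : ℝ) / n

/-- The fraction of perfect slots of the pattern `U` is `υ`, asymptotically in the block length. -/
def HasPerfectFraction {K : ℕ} (U : CSIPattern K) (υ : ℝ) : Prop :=
  Tendsto (perfectFraction U) atTop (𝓝 υ)

/-- The coefficients known to all transmitters and receivers. The unknown ones are replaced by
`0`; as the pattern is fixed, this array carries exactly the information of the known ones. -/
def knownCSI {K n : ℕ} (U : Fin K → Fin K → Finset (Fin n)) (h : Fading K n) : Fading K n :=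
  fun p q j => if j ∈ U p q then 0 else h p q j

/-- The direct channel matrix `F_p H^{[pp]}` of user `p`. -/
def directMatrix {K n : ℕ} (h : Fading K n) (F : Fin K → Matrix (Fin n) (Fin n) ℂ) (p : Fin K) :
    Matrix (Fin n) (Fin n) ℂ :=
  F p * Matrix.diagonal (h p p)

/-- The signal at receiver `p` when transmitter `q` sends the block `x q`. -/
def received {K n : ℕ} (s : ChannelState K n) (x : Fin K → Fin n → ℂ) (p : Fin K) : Fin n → ℂ :=
  fun j => (∑ q ∈ Finset.univ.erase p, s.1 p q j * x q j)
    + (directMatrix s.1 s.2.1 p).mulVec (x p) j + s.2.2 p j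

/-- A code of block length `n` with `N q` messages for user `q`. Transmitter `q` knows its own
message and the known coefficients; receiver `p` knows its received block, the known coefficients,
and its own direct channel matrix. -/
structure Code (K n : ℕ) (N : Fin K → ℕ) where
  enc : (q : Fin K) → Fin (N q) → Fading K n → Fin n → ℂ
  dec : (p : Fin K) → (Fin n → ℂ) × Fading K n × Matrix (Fin n) (Fin n) ℂ → Fin (N p)
  enc_measurable : ∀ q m, Measurable (enc q m)
  dec_measurable : ∀ p, Measurable (dec p)

/-- The total power across all transmitters is at most `ρ`. -/
def Code.HasPower {K n : ℕ} {N : Fin K → ℕ} (c : Code K n N) (ρ : ℝ) : Prop :=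
  ∀ (m : (q : Fin K) → Fin (N q)) (θ : Fading K n),
    ∑ q, ∑ j, ‖c.enc q (m q) θ j‖ ^ 2 ≤ n * ρ

/-- The event that some receiver does not recover its message, when `m` is sent. -/
def Code.errorEvent {K n : ℕ} {N : Fin K → ℕ} (c : Code K n N)
    (U : Fin K → Fin K → Finset (Fin n)) (m : (q : Fin K) → Fin (N q)) :
    Set (ChannelState K n) :=
  {s | ∃ p, c.dec p (received s (fun q => c.enc q (m q) (knownCSI U s.1)) p, knownCSI U s.1,
    directMatrix s.1 s.2.1 p) ≠ m p}

/-- The probability of error, for independent and uniformly distributed messages. -/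
def Code.errorProb {K n : ℕ} {N : Fin K → ℕ} (c : Code K n N) (L : ChannelLaw)
    (U : Fin K → Fin K → Finset (Fin n)) : ℝ :=
  (∑ m : (q : Fin K) → Fin (N q), (L.stateLaw K n).real (c.errorEvent U m)) / ∏ q, (N q : ℝ)

/-- The rates `R` (in bits per slot) are achievable with total power `ρ`. -/
def ChannelLaw.IsAchievable (L : ChannelLaw) {K : ℕ} (U : CSIPattern K) (ρ : ℝ)
    (R : Fin K → ℝ) : Prop :=
  (∀ q, 0 ≤ R q) ∧ ∀ ε : ℝ, 0 < ε → ∀ᶠ n : ℕ in atTop,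
    ∃ (N : Fin K → ℕ) (c : Code K n N), (∀ q, (2 : ℝ) ^ ((n : ℝ) * R q) ≤ N q) ∧
      c.HasPower ρ ∧ c.errorProb L (U n) ≤ ε

/-- The capacity region with total power `ρ`. -/
def ChannelLaw.capacityRegion (L : ChannelLaw) {K : ℕ} (U : CSIPattern K) (ρ : ℝ) :
    Set (Fin K → ℝ) :=
  closure {R | L.IsAchievable U ρ R}

/-- The degrees of freedom region. -/
def ChannelLaw.dofRegion (L : ChannelLaw) {K : ℕ} (U : CSIPattern K) : Set (Fin K → ℝ) :=
  {d | (∀ q, 0 ≤ d q) ∧ ∀ w : Fin K → ℝ, (∀ q, 0 ≤ w q) →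
    ((∑ q, w q * d q : ℝ) : EReal) ≤
      limsup (fun ρ : ℝ => ⨆ R ∈ L.capacityRegion U ρ,
        (((∑ q, w q * R q) / Real.logb 2 ρ : ℝ) : EReal)) atTop}

/-- The maximum number `K / 2` of (sum) degrees of freedom is achieved. -/
def ChannelLaw.AchievesMaxDoF (L : ChannelLaw) {K : ℕ} (U : CSIPattern K) : Prop :=
  ∃ d ∈ L.dofRegion U, ∑ q, d q = (K : ℝ) / 2

/-- The fractions `υ` such that perfect channel state information in a fraction `υ` of the time is
enough to achieve the maximum degrees of freedom of the `K`-user channel, whatever the pattern. -/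
def ChannelLaw.sufficientFractions (L : ChannelLaw) (K : ℕ) : Set ℝ :=
  {υ | υ ∈ Set.Icc (0 : ℝ) 1 ∧ ∀ U : CSIPattern K, HasPerfectFraction U υ → L.AchievesMaxDoF U}

/-- `Υ_K`, the minimum (infimum) of the sufficient fractions. It is `⊤` if there is none, and an
element of `[0, 1]` otherwise. -/
def ChannelLaw.minCSIFraction (L : ChannelLaw) (K : ℕ) : EReal :=
  sInf ((fun υ : ℝ => (υ : EReal)) '' L.sufficientFractions K)

end InterferenceChannel

end

/-! The claim reduces to an inclusion: for `2 ≤ K`, a fraction that suffices for `K + 1` users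
suffices for `K` users (`ChannelLaw.sufficientFractions_succ_subset`). A pattern for `K` users
extends to one more user by making all links of the new user known, which keeps the perfect
fraction. Let `d` be a point of the larger DoF region with sum `(K + 1) / 2`. Any two users satisfy
`d p + d q ≤ 1`; summing this over the pairs that contain the last user shows that the last user has
at most `1 / 2`. Hence the others keep at least `K / 2`, and scaling down gives a point with sum
exactly `K / 2`.

Two facts carry this. First, deleting users does no harm (`Code.exists_restrict`): the messages and
links of the deleted users are frozen at values no worse than average, and each remaining receiver
adds the missing interference itself. Second, two users have at most one degree of freedom under any
CSI pattern (`ChannelLaw.exists_sum_rate_le`).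

The second fact is proved with volumes instead of entropies. Receiver 0 decodes its own message and
subtracts its own signal; what remains is the interfering codeword up to noise. The codewords of
user 1 that are compatible with this remainder lie in a ball of radius of order `√n`. Receiver 1 can
tell only exponentially many of them apart, at a rate independent of the power, because a linear map
with Gram trace of order `n` enlarges volumes at most exponentially. So every point of the output
space of receiver 0 is used by few message pairs, and the volume of that space, of order `(C ρ) ^
n`, bounds the number of pairs. -/

noncomputable section

namespace InterferenceChannel

/-! ### Energy, Gaussian noise and volumes of balls -/

/-- The energy of a block of complex symbols. -/
def energy {n : ℕ} (x : Fin n → ℂ) : ℝ := ∑ j, ‖x j‖ ^ 2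

lemma energy_nonneg {n : ℕ} (x : Fin n → ℂ) : 0 ≤ energy x :=
  Finset.sum_nonneg fun _ _ => by positivity

@[fun_prop]
lemma measurable_energy {n : ℕ} : Measurable (energy (n := n)) := by
  unfold energy; fun_prop

lemma energy_add_le {n : ℕ} (x y : Fin n → ℂ) :
    energy (x + y) ≤ 2 * energy x + 2 * energy y := by
  unfold energy
  rw [Finset.mul_sum, Finset.mul_sum, ← Finset.sum_add_distrib]
  refine Finset.sum_le_sum fun j _ => ?_
  have h := norm_add_le (x j) (y j)
  have h0 := norm_nonneg (x j + y j)
  simp only [Pi.add_apply]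
  nlinarith [sq_nonneg (‖x j‖ - ‖y j‖)]

lemma energy_smul {n : ℕ} (c : ℝ) (x : Fin n → ℂ) : energy (c • x) = c ^ 2 * energy x := by
  unfold energy
  rw [Finset.mul_sum]
  exact Finset.sum_congr rfl fun j _ => by simp [mul_pow]

/-- The product outer measure is the largest one bounded on boxes by the product of the side
measures, so it is monotone in the factors. -/
lemma measure_pi_mono {ι : Type*} [Fintype ι] {α : ι → Type*} [∀ i, MeasurableSpace (α i)]
    {μ ν : ∀ i, Measure (α i)} (h : ∀ i, μ i ≤ ν i) : Measure.pi μ ≤ Measure.pi ν := by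
  refine Measure.le_iff.2 fun s hs => ?_
  rw [Measure.pi, Measure.pi, toMeasure_apply _ _ hs, toMeasure_apply _ _ hs]
  refine OuterMeasure.le_pi.2 (fun t _ => ?_) s
  exact (OuterMeasure.pi_pi_le _ t).trans (Finset.prod_le_prod' fun i _ => h i (t i))

instance isProbabilityMeasure_noiseLaw : IsProbabilityMeasure noiseLaw := by
  unfold noiseLaw
  exact Measure.isProbabilityMeasure_map
    (Complex.measurableEquivRealProd.symm.measurable.aemeasurable)

lemma gaussianReal_half_le_volume : gaussianReal 0 (1 / 2) ≤ volume := by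
  rw [gaussianReal_of_var_ne_zero _ (by norm_num)]
  conv_rhs => rw [← withDensity_one (μ := (volume : Measure ℝ))]
  refine withDensity_mono (Eventually.of_forall fun x => ?_)
  rw [gaussianPDF, Pi.one_apply, ENNReal.ofReal_le_one, gaussianPDFReal]
  have h1 : (√(2 * Real.pi * ((1 / 2 : NNReal) : ℝ)))⁻¹ ≤ 1 := by
    refine inv_le_one_of_one_le₀ (Real.one_le_sqrt.2 ?_)
    push_cast
    linarith [Real.pi_gt_three]
  have h2 : Real.exp (-(x - 0) ^ 2 / (2 * ((1 / 2 : NNReal) : ℝ))) ≤ 1 := by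
    refine Real.exp_le_one_iff.2 ?_
    push_cast
    nlinarith [sq_nonneg (x - 0)]
  exact mul_le_one₀ h1 (Real.exp_nonneg _) h2

/-- The density of each real component is at most `1 / √π < 1`. Probabilities of noise events are
thereby lower bounds for volumes, with no constant lost. -/
lemma noiseLaw_le_volume : noiseLaw ≤ volume := by
  rw [← Complex.volume_preserving_equiv_real_prod.symm.map_eq]
  unfold noiseLaw
  refine Measure.map_mono ?_ Complex.measurableEquivRealProd.symm.measurable
  exact Measure.prod_mono gaussianReal_half_le_volume gaussianReal_half_le_volume

lemma lintegral_norm_sq_noiseLaw_lt_top : ∫⁻ z, ENNReal.ofReal (‖z‖ ^ 2) ∂noiseLaw < ⊤ := by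
  unfold noiseLaw
  have hmeas : Measurable fun z : ℝ × ℝ => (⟨z.1, z.2⟩ : ℂ) :=
    Complex.measurableEquivRealProd.symm.measurable
  rw [lintegral_map (by fun_prop) hmeas]
  have key : ∀ z : ℝ × ℝ, ENNReal.ofReal (‖(⟨z.1, z.2⟩ : ℂ)‖ ^ 2) =
      ENNReal.ofReal (z.1 ^ 2) + ENNReal.ofReal (z.2 ^ 2) := fun z => by
    rw [← ENNReal.ofReal_add (by positivity) (by positivity), Complex.sq_norm,
      Complex.normSq_mk]
    ring_nf
  have fin : ∫⁻ x, ENNReal.ofReal (x ^ 2) ∂(gaussianReal 0 (1 / 2)) < ⊤ := by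
    have h := (memLp_id_gaussianReal' (μ := 0) (v := 1 / 2) 2 (by norm_num)).integrable_sq
    have := h.lintegral_lt_top
    simpa using this
  simp_rw [key]
  rw [lintegral_add_left (by fun_prop)]
  rw [lintegral_prod _ (by fun_prop), lintegral_prod _ (by fun_prop)]
  simpa using fin

/-- The law of the noise at a receiver over a block of length `n`. -/
def blockNoise (n : ℕ) : Measure (Fin n → ℂ) := Measure.pi fun _ => noiseLaw

instance isProbabilityMeasure_blockNoise (n : ℕ) : IsProbabilityMeasure (blockNoise n) := by
  unfold blockNoise; infer_instance

lemma blockNoise_le_volume (n : ℕ) : blockNoise n ≤ volume :=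
  measure_pi_mono fun _ => noiseLaw_le_volume

lemma lintegral_energy_blockNoise (n : ℕ) :
    ∫⁻ z, ENNReal.ofReal (energy z) ∂(blockNoise n) =
      n * ∫⁻ z, ENNReal.ofReal (‖z‖ ^ 2) ∂noiseLaw := by
  have : ∀ z : Fin n → ℂ, ENNReal.ofReal (energy z) = ∑ j, ENNReal.ofReal (‖z j‖ ^ 2) :=
    fun z => ENNReal.ofReal_sum_of_nonneg fun _ _ => by positivity
  simp_rw [this]
  rw [lintegral_finsetSum _ fun j _ => by fun_prop]
  have h : ∀ j : Fin n, ∫⁻ z, ENNReal.ofReal (‖z j‖ ^ 2) ∂(blockNoise n) =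
      ∫⁻ z, ENNReal.ofReal (‖z‖ ^ 2) ∂noiseLaw := fun j =>
    (measurePreserving_eval (fun _ : Fin n => noiseLaw) j).lintegral_comp
      (f := fun z => ENNReal.ofReal (‖z‖ ^ 2)) (by fun_prop)
  simp_rw [h]
  simp

/-- Markov's inequality at eight times the mean energy; the `+ 1` in the witness only ensures
positivity. -/
lemma exists_blockNoise_energy_tail_le :
    ∃ R : ℝ, 0 < R ∧ ∀ n : ℕ, blockNoise n {z | R * n < energy z} ≤ 1 / 8 := by
  set σ := ∫⁻ z, ENNReal.ofReal (‖z‖ ^ 2) ∂noiseLaw with hσ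
  have hσt : σ ≠ ⊤ := lintegral_norm_sq_noiseLaw_lt_top.ne
  refine ⟨8 * (σ.toReal + 1), by positivity, fun n => ?_⟩
  rcases Nat.eq_zero_or_pos n with rfl | hn
  · simp [energy]
  have hn' : (0 : ℝ) < n := by exact_mod_cast hn
  have hpos : 0 < 8 * (σ.toReal + 1) * n := by positivity
  have h := mul_meas_ge_le_lintegral (μ := blockNoise n)
    (f := fun z => ENNReal.ofReal (energy z)) (by fun_prop)
    (ENNReal.ofReal (8 * (σ.toReal + 1) * n))
  rw [lintegral_energy_blockNoise, ← hσ] at h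
  have hsub : {z : Fin n → ℂ | 8 * (σ.toReal + 1) * n < energy z} ⊆
      {z | ENNReal.ofReal (8 * (σ.toReal + 1) * n) ≤ ENNReal.ofReal (energy z)} :=
    fun z hz => ENNReal.ofReal_le_ofReal (le_of_lt hz)
  refine (measure_mono hsub).trans ?_
  rw [← ENNReal.ofReal_toReal hσt, ← ENNReal.ofReal_natCast,
    ← ENNReal.ofReal_mul (by positivity), mul_comm, ENNReal.toReal_ofReal (by positivity)] at h
  refine (ENNReal.le_div_iff_mul_le (Or.inl (by simpa using hpos))
    (Or.inl ENNReal.ofReal_ne_top)).2 h |>.trans ?_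
  rw [← ENNReal.ofReal_div_of_pos hpos, ENNReal.ofReal_le_iff_le_toReal (by simp),
    div_le_iff₀ hpos]
  simp only [one_div, ENNReal.toReal_inv, ENNReal.toReal_ofNat]
  nlinarith [ENNReal.toReal_nonneg (a := σ)]

/-- A Chernoff bound: on the ball, `1 ≤ exp (R n) * ∏ exp (-|z j|²)`, and the right side integrates
to the `n`-th power of a constant. -/
lemma exists_volume_energy_le (R : ℝ) :
    ∃ C : ℝ, 1 ≤ C ∧ ∀ n : ℕ,
      volume {z : Fin n → ℂ | energy z ≤ R * n} ≤ ENNReal.ofReal (C ^ n) := by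
  have hint : Integrable fun z : ℂ => Real.exp (-‖z‖ ^ 2) := by
    refine (GaussianFourier.integrable_cexp_neg_mul_sq_norm_add (V := ℂ) (b := 1)
      (by simp) 0 0).norm.congr (Eventually.of_forall fun z => ?_)
    change ‖Complex.exp _‖ = Real.exp _
    rw [Complex.norm_exp]
    congr 1
    simp [← Complex.ofReal_pow]
  set κ := ∫ z : ℂ, Real.exp (-‖z‖ ^ 2) with hκ
  have hκ0 : 0 ≤ κ := integral_nonneg fun _ => Real.exp_nonneg _
  refine ⟨Real.exp R * κ + 1, by simp; positivity, fun n => ?_⟩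
  have hle : volume {z : Fin n → ℂ | energy z ≤ R * n} ≤
      ∫⁻ z : Fin n → ℂ, ENNReal.ofReal (Real.exp R ^ n) *
        ∏ j, ENNReal.ofReal (Real.exp (-‖z j‖ ^ 2)) := by
    rw [← lintegral_indicator_one (measurableSet_le (by fun_prop) (by fun_prop))]
    refine lintegral_mono fun z => ?_
    refine Set.indicator_le' (s := {z : Fin n → ℂ | energy z ≤ R * n})
      (g := fun z => ENNReal.ofReal (Real.exp R ^ n) *
        ∏ j, ENNReal.ofReal (Real.exp (-‖z j‖ ^ 2))) (fun z hz => ?_)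
        (fun _ _ => zero_le) z
    rw [← ENNReal.ofReal_prod_of_nonneg fun _ _ => Real.exp_nonneg _,
      ← ENNReal.ofReal_mul (by positivity), Pi.one_apply, ENNReal.one_le_ofReal,
      ← Real.exp_nat_mul, ← Real.exp_sum, ← Real.exp_add, Real.one_le_exp_iff,
      Finset.sum_neg_distrib]
    simp only [Set.mem_ofPred_eq, energy] at hz
    linarith
  refine hle.trans ?_
  rw [lintegral_const_mul _ (by fun_prop)]
  have hprod : ∫⁻ z : Fin n → ℂ, ∏ j, ENNReal.ofReal (Real.exp (-‖z j‖ ^ 2)) =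
      ENNReal.ofReal (κ ^ n) := by
    have h := integral_fintype_prod_volume_eq_pow (ι := Fin n) (fun z : ℂ => Real.exp (-‖z‖ ^ 2))
    rw [Fintype.card_fin] at h
    have hi : Integrable (fun z : Fin n → ℂ => ∏ j, Real.exp (-‖z j‖ ^ 2)) volume :=
      Integrable.fintype_prod (f := fun (_ : Fin n) (z : ℂ) => Real.exp (-‖z‖ ^ 2)) fun _ => hint
    rw [hκ, ← h, ofReal_integral_eq_lintegral_ofReal hi
      (Eventually.of_forall fun _ => Finset.prod_nonneg fun _ _ => Real.exp_nonneg _)]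
    exact lintegral_congr fun z =>
      (ENNReal.ofReal_prod_of_nonneg fun _ _ => Real.exp_nonneg _).symm
  rw [hprod, ← ENNReal.ofReal_mul (by positivity), ← mul_pow]
  gcongr
  linarith

open Matrix
open scoped ComplexOrder MatrixOrder Pointwise

/-! ### Volume of a linear image of a ball, thickened by a ball -/

lemma volume_image_mulVec {n : ℕ} (A : Matrix (Fin n) (Fin n) ℂ) (s : Set (Fin n → ℂ)) :
    volume ((A *ᵥ ·) '' s) = ENNReal.ofReal (‖A.det‖ ^ 2) * volume s := by
  have h := Measure.addHaar_image_linearMap (volume : Measure (Fin n → ℂ))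
    ((Matrix.mulVecLin A).restrictScalars ℝ) s
  rw [LinearMap.det_restrictScalars] at h
  have hd : LinearMap.det (Matrix.mulVecLin A) = A.det := LinearMap.det_toLin' A
  rw [hd, Algebra.norm_complex_apply, Complex.normSq_eq_norm_sq, abs_of_nonneg (by positivity)] at h
  exact h

/-- Each eigenvalue satisfies `x ≤ exp (x - 1)`; multiply over the spectrum. -/
lemma norm_det_le_exp_trace {n : ℕ} {P : Matrix (Fin n) (Fin n) ℂ} (hP : P.PosSemidef) :
    ‖P.det‖ ≤ Real.exp (P.trace.re - n) := by
  rw [hP.isHermitian.det_eq_prod_eigenvalues, hP.isHermitian.trace_eq_sum_eigenvalues, norm_prod]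
  have h : (∑ i, (hP.isHermitian.eigenvalues i : ℂ)).re - n =
      ∑ i, (hP.isHermitian.eigenvalues i - 1) := by
    rw [Finset.sum_sub_distrib]; simp
  refine le_of_le_of_eq ?_ (congrArg Real.exp h).symm
  rw [Real.exp_sum]
  refine Finset.prod_le_prod (fun _ _ => norm_nonneg _) fun i _ => ?_
  have h0 := hP.eigenvalues_nonneg i
  have := Real.add_one_le_exp (hP.isHermitian.eigenvalues i - 1)
  simp [abs_of_nonneg h0]
  linarith

/-- The sum of a linear image of a ball and of a ball. -/
def sumset {n : ℕ} (M : Matrix (Fin n) (Fin n) ℂ) (r : ℝ) : Set (Fin n → ℂ) :=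
  {y | ∃ u v : Fin n → ℂ, energy u ≤ r ∧ energy v ≤ r ∧ y = M *ᵥ u + v}

lemma energy_eq_re_dotProduct {n : ℕ} (x : Fin n → ℂ) : energy x = (star x ⬝ᵥ x).re := by
  simp only [energy, dotProduct, Complex.re_sum, Pi.star_apply]
  exact Finset.sum_congr rfl fun j _ => by
    rw [Complex.sq_norm, Complex.normSq_apply]; simp

lemma two_mul_re_dotProduct_le {n : ℕ} (x y : Fin n → ℂ) :
    2 * (star x ⬝ᵥ y).re ≤ energy x + energy y := by
  simp only [energy, dotProduct, Complex.re_sum, Pi.star_apply]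
  rw [Finset.mul_sum, ← Finset.sum_add_distrib]
  refine Finset.sum_le_sum fun j _ => ?_
  rw [Complex.sq_norm, Complex.normSq_apply, Complex.sq_norm, Complex.normSq_apply]
  simp
  nlinarith [sq_nonneg ((x j).re - (y j).re), sq_nonneg ((x j).im - (y j).im)]

/-- The sumset lies in an ellipsoid. With `1 + M Mᴴ = Bᴴ B` and `y = M u + v = (1 + M Mᴴ) ξ`, the
preimage `B ξ` of `y` under `Bᴴ` has energy `E = |ξ|² + |Mᴴ ξ|² = Re ⟨Mᴴ ξ, u⟩ + Re ⟨ξ, v⟩`. Hence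
`2 E ≤ E + 2 r`, that is, `E ≤ 2 r`. -/
lemma volume_sumset_le {n : ℕ} (M : Matrix (Fin n) (Fin n) ℂ) (r : ℝ) :
    volume (sumset M r) ≤ ENNReal.ofReal (Real.exp ((M * Mᴴ).trace.re)) *
      volume {w : Fin n → ℂ | energy w ≤ 2 * r} := by
  have hPd : (1 + M * Mᴴ).PosDef :=
    Matrix.PosDef.one.add_posSemidef (Matrix.posSemidef_self_mul_conjTranspose M)
  obtain ⟨B, hB⟩ := CStarAlgebra.nonneg_iff_eq_star_mul_self.1 hPd.posSemidef.nonneg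
  rw [Matrix.star_eq_conjTranspose] at hB
  have hdet : ‖Bᴴ.det‖ ^ 2 ≤ Real.exp ((M * Mᴴ).trace.re) := by
    have h := norm_det_le_exp_trace hPd.posSemidef
    have h2 : ‖(1 + M * Mᴴ).det‖ = ‖Bᴴ.det‖ ^ 2 := by
      rw [hB, Matrix.det_mul, norm_mul, Matrix.det_conjTranspose, norm_star, sq]
    rw [h2] at h
    simpa using h
  have hunit : IsUnit (1 + M * Mᴴ).det := (Matrix.isUnit_iff_isUnit_det _).1 hPd.isUnit
  have hsub : sumset M r ⊆ (Bᴴ *ᵥ ·) '' {w : Fin n → ℂ | energy w ≤ 2 * r} := by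
    rintro y ⟨u, v, hu, hv, rfl⟩
    set y := M *ᵥ u + v with hy
    obtain ⟨ξ, hPξ⟩ : ∃ ξ, (1 + M * Mᴴ) *ᵥ ξ = y := ⟨(1 + M * Mᴴ)⁻¹ *ᵥ y, by
      rw [Matrix.mulVec_mulVec, Matrix.mul_nonsing_inv _ hunit, Matrix.one_mulVec]⟩
    refine ⟨B *ᵥ ξ, ?_, ?_⟩
    · have hq1 : energy (B *ᵥ ξ) = (star ξ ⬝ᵥ y).re := by
        rw [energy_eq_re_dotProduct, Matrix.star_mulVec, ← Matrix.dotProduct_mulVec,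
          Matrix.mulVec_mulVec, ← hB, hPξ]
      have hq2 : energy (B *ᵥ ξ) = energy ξ + energy (Mᴴ *ᵥ ξ) := by
        rw [hq1, ← hPξ, Matrix.add_mulVec, Matrix.one_mulVec, dotProduct_add, Complex.add_re,
          ← energy_eq_re_dotProduct, energy_eq_re_dotProduct (Mᴴ *ᵥ ξ), Matrix.star_mulVec,
          ← Matrix.dotProduct_mulVec, Matrix.mulVec_mulVec, Matrix.conjTranspose_conjTranspose]
      have hq3 : (star ξ ⬝ᵥ y).re = (star (Mᴴ *ᵥ ξ) ⬝ᵥ u).re + (star ξ ⬝ᵥ v).re := by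
        rw [hy, dotProduct_add, Complex.add_re, Matrix.star_mulVec,
          ← Matrix.dotProduct_mulVec, Matrix.conjTranspose_conjTranspose]
      have h1 := two_mul_re_dotProduct_le (Mᴴ *ᵥ ξ) u
      have h2 := two_mul_re_dotProduct_le ξ v
      change energy (B *ᵥ ξ) ≤ 2 * r
      linarith
    · change Bᴴ *ᵥ (B *ᵥ ξ) = y
      rw [Matrix.mulVec_mulVec, ← hB, hPξ]
  refine (measure_mono hsub).trans ?_
  rw [volume_image_mulVec]
  gcongr

/-- If the Gram matrix of `M` has trace of the order of `n`, then the sumset of radius of the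
order of `√n` has volume at most exponential in `n`. -/
lemma exists_volume_sumset_le (R t : ℝ) :
    ∃ C : ℝ, 1 ≤ C ∧ ∀ (n : ℕ) (M : Matrix (Fin n) (Fin n) ℂ),
      (M * Mᴴ).trace.re ≤ t * n → volume (sumset M (R * n)) ≤ ENNReal.ofReal (C ^ n) := by
  obtain ⟨C, hC1, hC⟩ := exists_volume_energy_le (2 * R)
  refine ⟨Real.exp |t| * C, ?_, fun n M hM => ?_⟩
  · have : 1 ≤ Real.exp |t| := Real.one_le_exp (abs_nonneg t)
    nlinarith
  refine (volume_sumset_le M _).trans ?_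
  rw [mul_pow, ENNReal.ofReal_mul (by positivity), ← mul_assoc]
  gcongr
  · rw [← Real.exp_nat_mul, Real.exp_le_exp]
    have : t * n ≤ n * |t| := by
      rw [mul_comm]; gcongr; exact le_abs_self t
    linarith
  · exact hC n

lemma volume_smul {n : ℕ} (c : ℝ) (s : Set (Fin n → ℂ)) :
    volume (c • s) = ENNReal.ofReal ((c ^ 2) ^ n) * volume s := by
  rw [Measure.addHaar_smul]
  have : Module.finrank ℝ (Fin n → ℂ) = 2 * n := by
    rw [Module.finrank_pi_fintype]; simp [mul_comm]
  rw [this, pow_mul, abs_of_nonneg (by positivity)]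

/-! ### Counting messages by volumes of decision regions -/

lemma blockNoise_add_left_le {n : ℕ} (c : Fin n → ℂ) (A : Set (Fin n → ℂ)) :
    blockNoise n {z | c + z ∈ A} ≤ volume A :=
  (blockNoise_le_volume n _).trans_eq (measure_preimage_add volume c A)

/-- The noise takes the received signal into the decision region of `m` and has a typical energy,
except for the event of an error and an event of small probability. -/
lemma le_volume_decision_region {n : ℕ} {ι : Type*} {R : ℝ}
    (hR : blockNoise n {z | R * n < energy z} ≤ 1 / 8) (dec : (Fin n → ℂ) → ι) (m : ι)
    (c : Fin n → ℂ) :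
    ENNReal.ofReal (7 / 8 - (blockNoise n).real {z | dec (c + z) ≠ m}) ≤
      volume {y | dec y = m ∧ energy (y - c) ≤ R * n} := by
  refine le_trans ?_ (blockNoise_add_left_le c _)
  have hsub : (Set.univ : Set (Fin n → ℂ)) ⊆ ({z | dec (c + z) ≠ m} ∪ {z | R * n < energy z}) ∪
      {z | c + z ∈ {y | dec y = m ∧ energy (y - c) ≤ R * n}} := by
    intro z _
    by_cases h1 : dec (c + z) = m
    · by_cases h2 : R * n < energy z
      · exact Or.inl (Or.inr h2)
      · right
        change dec (c + z) = m ∧ energy (c + z - c) ≤ R * n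
        rw [add_sub_cancel_left]
        exact ⟨h1, not_lt.1 h2⟩
    · exact Or.inl (Or.inl h1)
  have h := measureReal_mono (μ := blockNoise n) hsub
  rw [probReal_univ] at h
  have h2 := measureReal_union_le (μ := blockNoise n)
    ({z | dec (c + z) ≠ m} ∪ {z | R * n < energy z})
      {z | c + z ∈ {y | dec y = m ∧ energy (y - c) ≤ R * n}}
  have h3 := measureReal_union_le (μ := blockNoise n)
    {z | dec (c + z) ≠ m} {z | R * n < energy z}
  have h4 : (blockNoise n).real {z | R * n < energy z} ≤ 1 / 8 := by
    have := ENNReal.toReal_mono (by simp) hR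
    simpa [Measure.real] using this
  refine ENNReal.ofReal_le_of_le_toReal ?_
  change _ ≤ (blockNoise n).real _
  linarith

/-- Decoding limits the number of codewords in a ball. -/
lemma card_codewords_near_le {n N : ℕ} {R V : ℝ} (hV : 0 ≤ V)
    (hR : blockNoise n {z | R * n < energy z} ≤ 1 / 8)
    (M : Matrix (Fin n) (Fin n) ℂ) (hM : volume (sumset M (R * n)) ≤ ENNReal.ofReal V)
    (b : Fin N → Fin n → ℂ) (s y : Fin n → ℂ) (dec : (Fin n → ℂ) → Fin N)
    (hdec : Measurable dec) (I : Finset (Fin N))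
    (hgood : ∀ m ∈ I, (blockNoise n).real {z | dec (M *ᵥ b m + s + z) ≠ m} ≤ 1 / 2)
    (hnear : ∀ m ∈ I, energy (y - b m) ≤ R * n) :
    (I.card : ℝ) ≤ 8 / 3 * V := by
  have hmeas : ∀ m, MeasurableSet
      {y | dec y = m ∧ energy (y - (M *ᵥ b m + s)) ≤ R * n} := fun m =>
    (measurableSet_eq_fun hdec measurable_const).inter
      (measurableSet_le (measurable_energy.comp (measurable_id.sub_const _)) measurable_const)
  -- `3 / 8 = 7 / 8 - 1 / 2`: the mass of typical noise minus the allowed error.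
  have h1 : ∑ m ∈ I, ENNReal.ofReal (3 / 8) ≤
      ∑ m ∈ I, volume {y | dec y = m ∧ energy (y - (M *ᵥ b m + s)) ≤ R * n} := by
    refine Finset.sum_le_sum fun m hm =>
      le_trans (ENNReal.ofReal_le_ofReal ?_) (le_volume_decision_region hR dec m _)
    linarith [hgood m hm]
  rw [← measure_biUnion_finset (fun m _ m' _ hne => Set.disjoint_left.2
    fun y hy hy' => hne (hy.1.symm.trans hy'.1)) fun m _ => hmeas m] at h1
  have h2 : volume (⋃ m ∈ I, {y | dec y = m ∧ energy (y - (M *ᵥ b m + s)) ≤ R * n}) ≤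
      ENNReal.ofReal V := by
    -- All the truncated decision regions lie in one translate of the sumset, centred at `M y + s`:
    -- the displacement `b m - y` and the noise both have energy at most `R n`.
    refine (measure_mono ?_).trans
      ((measure_preimage_add volume (-(M *ᵥ y + s)) (sumset M (R * n))).trans_le hM)
    intro w hw
    simp only [Set.mem_iUnion] at hw
    obtain ⟨m, hm, hw⟩ := hw
    refine ⟨-(y - b m), w - (M *ᵥ b m + s), ?_, hw.2, ?_⟩
    · have := hnear m hm
      simpa [energy, norm_sub_rev] using this
    · rw [Matrix.mulVec_neg, Matrix.mulVec_sub]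
      change -(M *ᵥ y + s) + w = _
      abel
  have h3 := h1.trans h2
  rw [Finset.sum_const, nsmul_eq_mul, ← ENNReal.ofReal_natCast,
    ← ENNReal.ofReal_mul (by positivity), ENNReal.ofReal_le_ofReal_iff hV] at h3
  linarith

/-- The converse for two users and fixed channel coefficients: the number of pairs of messages is
bounded by a ratio of volumes. -/
lemma card_messages_le {n N₀ N₁ : ℕ} {R V W : ℝ} (hV : 0 ≤ V) (hW : 0 ≤ W)
    (hR : blockNoise n {z | R * n < energy z} ≤ 1 / 8)
    (M : Matrix (Fin n) (Fin n) ℂ) (hM : volume (sumset M (R * n)) ≤ ENNReal.ofReal V)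
    (a s : Fin N₀ → Fin n → ℂ) (b : Fin N₁ → Fin n → ℂ)
    (S : Set (Fin n → ℂ)) (hS : volume S ≤ ENNReal.ofReal W)
    (hmem : ∀ m₀ m₁ z, energy z ≤ R * n → a m₀ + b m₁ + z ∈ S)
    (dec₀ : (Fin n → ℂ) → Fin N₀) (hdec₀ : Measurable dec₀)
    (dec₁ : (Fin n → ℂ) → Fin N₁) (hdec₁ : Measurable dec₁)
    (herr₀ : ∑ m : Fin N₀ × Fin N₁,
      (blockNoise n).real {z | dec₀ (a m.1 + b m.2 + z) ≠ m.1} ≤ 1 / 16 * (N₀ * N₁))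
    (herr₁ : ∑ m : Fin N₀ × Fin N₁,
      (blockNoise n).real {z | dec₁ (M *ᵥ b m.2 + s m.1 + z) ≠ m.2} ≤ 1 / 16 * (N₀ * N₁)) :
    (N₀ * N₁ : ℝ) ≤ 6 * (V * W) := by
  classical
  set q₀ : Fin N₀ × Fin N₁ → ℝ := fun m =>
    (blockNoise n).real {z | dec₀ (a m.1 + b m.2 + z) ≠ m.1} with hq₀
  set q₁ : Fin N₀ × Fin N₁ → ℝ := fun m =>
    (blockNoise n).real {z | dec₁ (M *ᵥ b m.2 + s m.1 + z) ≠ m.2} with hq₁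
  set G := Finset.univ.filter fun m => q₁ m ≤ 1 / 2 with hG
  have hq₀0 : ∀ m, 0 ≤ q₀ m := fun m => measureReal_nonneg
  have hq₁0 : ∀ m, 0 ≤ q₁ m := fun m => measureReal_nonneg
  -- Markov: outside `G` the error exceeds `1 / 2`, so at most `2 / 16` of the pairs are excluded.
  have hcard : 7 / 8 * (N₀ * N₁ : ℝ) ≤ G.card := by
    have h1 : ∑ m : Fin N₀ × Fin N₁, (if m ∈ G then (0 : ℝ) else 1 / 2) ≤ ∑ m, q₁ m := by
      refine Finset.sum_le_sum fun m _ => ?_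
      split_ifs with h
      · exact hq₁0 m
      · simp only [hG, Finset.mem_filter_univ, not_le] at h
        exact h.le
    have h2 : ∀ m, (if m ∈ G then (0 : ℝ) else 1 / 2) = 1 / 2 - 1 / 2 * if m ∈ G then 1 else 0 :=
      fun m => by split_ifs <;> norm_num
    simp_rw [h2] at h1
    rw [Finset.sum_sub_distrib, ← Finset.mul_sum, Finset.sum_ite_mem, Finset.univ_inter] at h1
    simp only [Finset.sum_const, Finset.card_univ, Fintype.card_prod, Fintype.card_fin,
      nsmul_eq_mul, Nat.cast_mul, mul_one] at h1
    linarith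
  -- The fraction obtained is `7 / 8 * 7 / 8 - 1 / 16 = 45 / 64`, which exceeds `1 / 2`.
  have hlow : ENNReal.ofReal (1 / 2 * (N₀ * N₁ : ℝ)) ≤
      ∑ m ∈ G, volume {y | dec₀ y = m.1 ∧ energy (y - (a m.1 + b m.2)) ≤ R * n} := by
    refine le_trans ?_ (Finset.sum_le_sum fun m _ =>
      le_volume_decision_region hR dec₀ m.1 (a m.1 + b m.2))
    refine le_trans (ENNReal.ofReal_le_ofReal ?_) 
      (Finset.le_sum_of_subadditive ENNReal.ofReal ENNReal.ofReal_zero.le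
        (fun _ _ => ENNReal.ofReal_add_le) _ _)
    have h1 : ∑ m ∈ G, q₀ m ≤ ∑ m, q₀ m :=
      Finset.sum_le_sum_of_subset_of_nonneg (Finset.subset_univ _) fun m _ _ => hq₀0 m
    rw [Finset.sum_sub_distrib, Finset.sum_const, nsmul_eq_mul]
    have h0 : (0 : ℝ) ≤ N₀ * N₁ := by positivity
    linarith
  have hmeas : ∀ m : Fin N₀ × Fin N₁, MeasurableSet
      {y | dec₀ y = m.1 ∧ energy (y - (a m.1 + b m.2)) ≤ R * n} := fun m =>
    (measurableSet_eq_fun hdec₀ measurable_const).inter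
      (measurableSet_le (measurable_energy.comp (measurable_id.sub_const _)) measurable_const)
  have hup : ∑ m ∈ G, volume {y | dec₀ y = m.1 ∧ energy (y - (a m.1 + b m.2)) ≤ R * n} ≤
      ENNReal.ofReal (8 / 3 * V) * ENNReal.ofReal W := by
    calc _ = ∫⁻ y, ∑ m ∈ G,
          {y | dec₀ y = m.1 ∧ energy (y - (a m.1 + b m.2)) ≤ R * n}.indicator 1 y := by
          rw [lintegral_finsetSum _ fun m _ => measurable_one.indicator (hmeas m)]
          exact Finset.sum_congr rfl fun m _ => (lintegral_indicator_one (hmeas m)).symm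
      -- The regions overlap, but with bounded multiplicity: `y` determines the first message as
      -- `dec₀ y`, and the second then has its codeword near `y - a (dec₀ y)`. The measurable hull
      -- is used since `S` is not assumed measurable.
      _ ≤ ∫⁻ y, (toMeasurable volume S).indicator
            (fun _ => ENNReal.ofReal (8 / 3 * V)) y := by
          refine lintegral_mono fun y => ?_
          by_cases hy : y ∈ toMeasurable volume S
          · rw [Set.indicator_of_mem hy]
            set I := Finset.univ.filter fun m₁ : Fin N₁ =>
              q₁ (dec₀ y, m₁) ≤ 1 / 2 ∧ energy (y - a (dec₀ y) - b m₁) ≤ R * n with hI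
            have hIc := card_codewords_near_le hV hR M hM b (s (dec₀ y)) (y - a (dec₀ y)) dec₁
              hdec₁ I (fun m hm => (Finset.mem_filter.1 hm).2.1)
              (fun m hm => (Finset.mem_filter.1 hm).2.2)
            have hle : ∑ m ∈ G, {y | dec₀ y = m.1 ∧
                energy (y - (a m.1 + b m.2)) ≤ R * n}.indicator (1 : (Fin n → ℂ) → ENNReal) y ≤
                ∑ m ∈ I.map ⟨fun m₁ => (dec₀ y, m₁), fun _ _ h => (Prod.ext_iff.1 h).2⟩, 1 := by
              simp_rw [Set.indicator_apply]
              rw [← Finset.sum_filter]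
              refine Finset.sum_le_sum_of_subset fun m hm => ?_
              obtain ⟨hm1, hm2, hm3⟩ := Finset.mem_filter.1 hm
              refine Finset.mem_map.2 ⟨m.2, ?_, Prod.ext hm2 rfl⟩
              refine Finset.mem_filter.2 ⟨Finset.mem_univ _, ?_, ?_⟩
              · rw [hm2]; exact (Finset.mem_filter.1 hm1).2
              · rw [hm2, sub_sub]; exact hm3
            refine hle.trans ?_
            rw [Finset.sum_const, Finset.card_map, nsmul_eq_mul, mul_one,
              ← ENNReal.ofReal_natCast]
            exact ENNReal.ofReal_le_ofReal hIc
          · rw [Set.indicator_of_notMem hy]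
            refine le_of_eq (Finset.sum_eq_zero fun m _ => Set.indicator_of_notMem ?_ _)
            rintro ⟨-, h⟩
            refine hy (subset_toMeasurable _ _ ?_)
            have := hmem m.1 m.2 _ h
            rwa [add_sub_cancel] at this
      _ ≤ _ := by
          rw [lintegral_indicator_const (measurableSet_toMeasurable _ _), measure_toMeasurable]
          gcongr
  have h := hlow.trans hup
  rw [← ENNReal.ofReal_mul (by positivity), ENNReal.ofReal_le_ofReal_iff (by positivity)] at h
  have : 0 ≤ V * W := by positivity
  linarith

/-! ### Measurability -/

lemma measurable_matrix_iff {α : Type*} [MeasurableSpace α] {n : ℕ}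
    {f : α → Matrix (Fin n) (Fin n) ℂ} :
    Measurable f ↔ ∀ i j, Measurable fun x => f x i j := by
  constructor
  · intro h i j
    exact (measurable_pi_apply j).comp ((measurable_pi_apply (X := fun _ => Fin n → ℂ) i).comp h)
  · intro h
    exact measurable_pi_iff.2 fun i => measurable_pi_iff.2 fun j => h i j

lemma measurable_fading_iff {α : Type*} [MeasurableSpace α] {K n : ℕ} {f : α → Fading K n} :
    Measurable f ↔ ∀ p q j, Measurable fun x => f x p q j := by
  simp only [measurable_pi_iff]

lemma measurable_knownCSI {K n : ℕ} (U : Fin K → Fin K → Finset (Fin n)) :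
    Measurable (knownCSI U) := by
  refine measurable_fading_iff.2 fun p q j => ?_
  unfold knownCSI
  split_ifs
  · exact measurable_const
  · fun_prop

lemma measurable_directMatrix {K n : ℕ} (p : Fin K) :
    Measurable fun s : ChannelState K n => directMatrix s.1 s.2.1 p := by
  refine measurable_matrix_iff.2 fun i j => ?_
  simp only [directMatrix, Matrix.mul_diagonal]
  refine Measurable.mul ?_ (by fun_prop)
  exact measurable_matrix_iff.1 ((measurable_pi_apply p).comp (measurable_fst.comp measurable_snd))
    i j

lemma measurable_received {K n : ℕ} {x : ChannelState K n → Fin K → Fin n → ℂ}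
    (hx : ∀ q, Measurable fun s => x s q) (p : Fin K) :
    Measurable fun s => received s (x s) p := by
  refine measurable_pi_iff.2 fun j => ?_
  have hx' : ∀ q j, Measurable fun s => x s q j := fun q j => (measurable_pi_apply j).comp (hx q)
  have hd := measurable_matrix_iff.1 (measurable_directMatrix (K := K) (n := n) p)
  simp only [received, Matrix.mulVec, dotProduct]
  refine Measurable.add (Measurable.add ?_ ?_) ?_
  · exact Finset.measurable_fun_sum _ fun q _ => Measurable.mul (by fun_prop) (hx' q j)
  · exact Finset.measurable_fun_sum _ fun i _ => (hd j i).mul (hx' p i)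
  · fun_prop

lemma Code.measurableSet_errorEvent {K n : ℕ} {N : Fin K → ℕ} (c : Code K n N)
    (U : Fin K → Fin K → Finset (Fin n)) (m : (q : Fin K) → Fin (N q)) :
    MeasurableSet (c.errorEvent U m) := by
  have : c.errorEvent U m = ⋃ p, {s | c.dec p (received s
      (fun q => c.enc q (m q) (knownCSI U s.1)) p, knownCSI U s.1,
      directMatrix s.1 s.2.1 p) = m p}ᶜ := by
    ext s; simp [errorEvent]
  rw [this]
  refine MeasurableSet.iUnion fun p => MeasurableSet.compl ?_
  refine measurableSet_eq_fun ((c.dec_measurable p).comp ?_) measurable_const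
  have hk : Measurable fun s : ChannelState K n => knownCSI U s.1 :=
    (measurable_knownCSI U).comp measurable_fst
  exact (measurable_received (fun q => (c.enc_measurable q (m q)).comp hk) p).prodMk
    (hk.prodMk (measurable_directMatrix p))

/-! ### The laws of the components of the channel state -/

/-- The joint law of the fading coefficients. -/
def ChannelLaw.fadingLaw (L : ChannelLaw) (K n : ℕ) : Measure (Fading K n) :=
  Measure.pi fun _ => Measure.pi fun _ => Measure.pi fun _ => L.fading

/-- The joint law of the matrices `F_p`. -/
def ChannelLaw.directLaw (L : ChannelLaw) (K n : ℕ) :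
    Measure (Fin K → Matrix (Fin n) (Fin n) ℂ) :=
  Measure.pi fun p => L.direct p n

/-- The joint law of the noise at all receivers. -/
def noisesLaw (K n : ℕ) : Measure (Fin K → Fin n → ℂ) := Measure.pi fun _ => blockNoise n

instance (L : ChannelLaw) (K n : ℕ) : IsProbabilityMeasure (L.fadingLaw K n) := by
  unfold ChannelLaw.fadingLaw; infer_instance

instance (L : ChannelLaw) (K n : ℕ) : IsProbabilityMeasure (L.directLaw K n) := by
  unfold ChannelLaw.directLaw; infer_instance

instance (K n : ℕ) : IsProbabilityMeasure (noisesLaw K n) := by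
  unfold noisesLaw; infer_instance

lemma ChannelLaw.stateLaw_eq (L : ChannelLaw) (K n : ℕ) :
    L.stateLaw K n = (L.fadingLaw K n).prod ((L.directLaw K n).prod (noisesLaw K n)) := rfl

instance (L : ChannelLaw) (K n : ℕ) : IsProbabilityMeasure (L.stateLaw K n) := by
  rw [L.stateLaw_eq]; infer_instance

lemma ChannelLaw.ae_fadingLaw (L : ChannelLaw) (K n : ℕ) {P : ℂ → Prop}
    (hP : ∀ᵐ z ∂L.fading, P z) : ∀ᵐ h ∂(L.fadingLaw K n), ∀ p q j, P (h p q j) := by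
  simp only [ae_all_iff]
  intro p q j
  have h1 := (measurePreserving_eval (fun _ : Fin K =>
    Measure.pi fun _ : Fin K => Measure.pi fun _ : Fin n => L.fading) p)
  have h2 := (measurePreserving_eval (fun _ : Fin K => Measure.pi fun _ : Fin n => L.fading) q)
  have h3 := (measurePreserving_eval (fun _ : Fin n => L.fading) j)
  exact ((h3.comp h2).comp h1).quasiMeasurePreserving.ae hP

/-- There are realizations of the coefficients and of the matrices with typical properties and
with a small average probability of error. -/
lemma ChannelLaw.exists_good_realization (L : ChannelLaw) {n : ℕ} {N : Fin 2 → ℕ}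
    (c : Code 2 n N) (U : Fin 2 → Fin 2 → Finset (Fin n)) {a b : ℝ} (hN : ∀ q, 0 < N q)
    (hab : ∀ᵐ h ∂L.fading, a ≤ ‖h‖ ∧ ‖h‖ ≤ b) (hn : 0 < n)
    (hF : ∀ p : Fin 2, L.direct p n {F | 1 ≤ |(F * F.conjTranspose).trace.re / n - 1|} ≤ 1 / 4)
    (hc : c.errorProb L U ≤ 1 / 64) :
    ∃ (h : Fading 2 n) (F : Fin 2 → Matrix (Fin n) (Fin n) ℂ),
      (∀ p q j, a ≤ ‖h p q j‖ ∧ ‖h p q j‖ ≤ b) ∧ (∀ p, (F p * (F p)ᴴ).trace.re ≤ 2 * n) ∧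
      ∑ m, (noisesLaw 2 n).real {z | (h, F, z) ∈ c.errorEvent U m} ≤
        1 / 16 * ((N 0 : ℝ) * N 1) := by
  have hN0 : (0 : ℝ) < N 0 * N 1 := by
    have h0 : (0 : ℝ) < N 0 := by exact_mod_cast hN 0
    have h1 : (0 : ℝ) < N 1 := by exact_mod_cast hN 1
    positivity
  have hn' : (0 : ℝ) < n := by exact_mod_cast hn
  set f : Fading 2 n × (Fin 2 → Matrix (Fin n) (Fin n) ℂ) → ENNReal := fun w =>
    ∑ m, noisesLaw 2 n {z | (w.1, w.2, z) ∈ c.errorEvent U m} with hf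
  have hassoc : Measurable fun x : (Fading 2 n × (Fin 2 → Matrix (Fin n) (Fin n) ℂ)) ×
      (Fin 2 → Fin n → ℂ) => ((x.1.1, x.1.2, x.2) : ChannelState 2 n) := by fun_prop
  have hfm1 : ∀ m, Measurable fun w : Fading 2 n × (Fin 2 → Matrix (Fin n) (Fin n) ℂ) =>
      noisesLaw 2 n {z | (w.1, w.2, z) ∈ c.errorEvent U m} := fun m =>
    measurable_measure_prodMk_left (hassoc (c.measurableSet_errorEvent U m))
  have hfm : Measurable f := Finset.measurable_fun_sum _ fun m _ => hfm1 m
  have hint : ∫⁻ w, f w ∂((L.fadingLaw 2 n).prod (L.directLaw 2 n)) =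
      ∑ m, L.stateLaw 2 n (c.errorEvent U m) := by
    rw [hf, lintegral_finsetSum _ fun m _ => hfm1 m]
    refine Finset.sum_congr rfl fun m _ => ?_
    rw [lintegral_prod _ (hfm1 m).aemeasurable, L.stateLaw_eq,
      Measure.prod_apply (c.measurableSet_errorEvent U m)]
    refine lintegral_congr fun h => ?_
    rw [Measure.prod_apply (measurable_prodMk_left (c.measurableSet_errorEvent U m))]
    rfl
  have hsum : ∑ m, L.stateLaw 2 n (c.errorEvent U m) ≤
      ENNReal.ofReal (1 / 64 * ((N 0 : ℝ) * N 1)) := by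
    rw [Code.errorProb, div_le_iff₀ (by simpa [Fin.prod_univ_two] using hN0),
      Fin.prod_univ_two] at hc
    refine le_trans (le_of_eq ?_) (ENNReal.ofReal_le_ofReal hc)
    rw [ENNReal.ofReal_sum_of_nonneg fun _ _ => measureReal_nonneg]
    exact Finset.sum_congr rfl fun m _ => (ofReal_measureReal (measure_ne_top _ _)).symm
  have hA : (L.fadingLaw 2 n).prod (L.directLaw 2 n)
      {w | ENNReal.ofReal (1 / 16 * ((N 0 : ℝ) * N 1)) ≤ f w} ≤ 1 / 4 := by
    have h := mul_meas_ge_le_lintegral (μ := (L.fadingLaw 2 n).prod (L.directLaw 2 n)) hfm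
      (ENNReal.ofReal (1 / 16 * ((N 0 : ℝ) * N 1)))
    rw [mul_comm, hint] at h
    have hpos : 0 < 1 / 16 * ((N 0 : ℝ) * N 1) := by positivity
    refine ((ENNReal.le_div_iff_mul_le (Or.inl (ENNReal.ofReal_pos.2 hpos).ne')
      (Or.inl ENNReal.ofReal_ne_top)).2 (h.trans hsum)).trans ?_
    rw [← ENNReal.ofReal_div_of_pos hpos, ENNReal.ofReal_le_iff_le_toReal (by simp),
      div_le_iff₀ hpos]
    simp only [one_div, ENNReal.toReal_inv, ENNReal.toReal_ofNat]
    linarith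
  have hB : (L.fadingLaw 2 n).prod (L.directLaw 2 n)
      {w | ∃ p, 1 ≤ |(w.2 p * (w.2 p)ᴴ).trace.re / n - 1|} ≤ 1 / 4 + 1 / 4 := by
    have hone : ∀ p : Fin 2, (L.fadingLaw 2 n).prod (L.directLaw 2 n)
        {w | 1 ≤ |(w.2 p * (w.2 p)ᴴ).trace.re / n - 1|} ≤ 1 / 4 := fun p => by
      refine le_trans ?_ (hF p)
      have hp : MeasurePreserving
          (fun w : Fading 2 n × (Fin 2 → Matrix (Fin n) (Fin n) ℂ) => w.2 p)
          ((L.fadingLaw 2 n).prod (L.directLaw 2 n)) (L.direct p n) :=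
        (measurePreserving_eval (fun p : Fin 2 => L.direct p n) p).comp measurePreserving_snd
      rw [← hp.map_eq]
      exact Measure.le_map_apply hp.measurable.aemeasurable
        {F | 1 ≤ |(F * F.conjTranspose).trace.re / n - 1|}
    have hsub : {w : Fading 2 n × (Fin 2 → Matrix (Fin n) (Fin n) ℂ) |
        ∃ p, 1 ≤ |(w.2 p * (w.2 p)ᴴ).trace.re / n - 1|} ⊆
        {w | 1 ≤ |(w.2 0 * (w.2 0)ᴴ).trace.re / n - 1|} ∪
        {w | 1 ≤ |(w.2 1 * (w.2 1)ᴴ).trace.re / n - 1|} := by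
      rintro w ⟨p, hp⟩
      fin_cases p
      · exact Or.inl hp
      · exact Or.inr hp
    exact (measure_mono hsub).trans ((measure_union_le _ _).trans (add_le_add (hone 0) (hone 1)))
  have hC : (L.fadingLaw 2 n).prod (L.directLaw 2 n)
      {w | ¬ ∀ p q j, a ≤ ‖w.1 p q j‖ ∧ ‖w.1 p q j‖ ≤ b} = 0 :=
    (measurePreserving_fst (μ := L.fadingLaw 2 n)
      (ν := L.directLaw 2 n)).quasiMeasurePreserving.ae (L.ae_fadingLaw 2 n hab)
  -- The exceptional sets have mass at most `1 / 4` (Markov for the error), `1 / 4 + 1 / 4` (the two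
  -- traces) and `0` (the fading bounds).
  have hlt : (L.fadingLaw 2 n).prod (L.directLaw 2 n)
      (({w | ENNReal.ofReal (1 / 16 * ((N 0 : ℝ) * N 1)) ≤ f w} ∪
        {w | ∃ p, 1 ≤ |(w.2 p * (w.2 p)ᴴ).trace.re / n - 1|}) ∪
        {w | ¬ ∀ p q j, a ≤ ‖w.1 p q j‖ ∧ ‖w.1 p q j‖ ≤ b}) < 1 := by
    refine (measure_union_le _ _).trans_lt ?_
    rw [hC, add_zero]
    refine (measure_union_le _ _).trans_lt ((add_le_add hA hB).trans_lt ?_)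
    rw [← ENNReal.toReal_lt_toReal (by simp) (by simp)]
    rw [ENNReal.toReal_add (by simp) (by simp), ENNReal.toReal_add (by simp) (by simp)]
    norm_num
  obtain ⟨w, hw⟩ : ∃ w, w ∉ (({w | ENNReal.ofReal (1 / 16 * ((N 0 : ℝ) * N 1)) ≤ f w} ∪
        {w | ∃ p, 1 ≤ |(w.2 p * (w.2 p)ᴴ).trace.re / n - 1|}) ∪
        {w | ¬ ∀ p q j, a ≤ ‖w.1 p q j‖ ∧ ‖w.1 p q j‖ ≤ b}) := by
    by_contra hall
    rw [Set.eq_univ_of_forall fun w => not_not.1 fun h => hall ⟨w, h⟩, measure_univ] at hlt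
    exact lt_irrefl _ hlt
  simp only [Set.mem_union, not_or] at hw
  obtain ⟨⟨hw1, hw2⟩, hw3⟩ := hw
  refine ⟨w.1, w.2, not_not.1 hw3, fun p => ?_, ?_⟩
  · have h1 : ¬ 1 ≤ |(w.2 p * (w.2 p)ᴴ).trace.re / n - 1| := fun h => hw2 ⟨p, h⟩
    have h2 := (abs_lt.1 (not_le.1 h1)).2
    rw [sub_lt_iff_lt_add, div_lt_iff₀ hn'] at h2
    linarith
  · have h1 : f w ≤ ENNReal.ofReal (1 / 16 * ((N 0 : ℝ) * N 1)) := (not_le.1 hw1).le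
    have h2 := ENNReal.toReal_mono ENNReal.ofReal_ne_top h1
    rw [hf, ENNReal.toReal_ofReal (by positivity),
      ENNReal.toReal_sum fun m _ => measure_ne_top _ _] at h2
    exact h2

/-! ### The converse for two users -/

lemma trace_mul_conjTranspose_re {n : ℕ} (A : Matrix (Fin n) (Fin n) ℂ) :
    (A * Aᴴ).trace.re = ∑ i, ∑ j, ‖A i j‖ ^ 2 := by
  simp only [Matrix.trace, Matrix.diag_apply, Matrix.mul_apply, Matrix.conjTranspose_apply,
    Complex.re_sum]
  refine Finset.sum_congr rfl fun i _ => Finset.sum_congr rfl fun j _ => ?_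
  rw [Complex.sq_norm, Complex.normSq_apply]
  simp

lemma trace_mul_diagonal_le {n : ℕ} (A : Matrix (Fin n) (Fin n) ℂ) (d : Fin n → ℂ) {β t : ℝ}
    (hd : ∀ j, ‖d j‖ ≤ β) (hA : (A * Aᴴ).trace.re ≤ t * n) :
    ((A * diagonal d) * (A * diagonal d)ᴴ).trace.re ≤ β ^ 2 * t * n := by
  rw [mul_assoc (β ^ 2)]
  refine le_trans ?_ (mul_le_mul_of_nonneg_left hA (sq_nonneg β))
  rw [trace_mul_conjTranspose_re, trace_mul_conjTranspose_re, Finset.mul_sum]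
  refine Finset.sum_le_sum fun i _ => ?_
  rw [Finset.mul_sum]
  refine Finset.sum_le_sum fun j _ => ?_
  rw [Matrix.mul_diagonal, norm_mul, mul_pow, mul_comm]
  gcongr
  exact hd j

lemma energy_mul_le {n : ℕ} (d x : Fin n → ℂ) {β : ℝ} (hd : ∀ j, ‖d j‖ ≤ β) :
    energy (d * x) ≤ β ^ 2 * energy x := by
  unfold energy
  rw [Finset.mul_sum]
  refine Finset.sum_le_sum fun j _ => ?_
  rw [Pi.mul_apply, norm_mul, mul_pow]
  gcongr
  exact hd j

lemma mem_smul_sumset {n : ℕ} (M : Matrix (Fin n) (Fin n) ℂ) {ρ r : ℝ} (hρ : 0 < ρ)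
    {x w : Fin n → ℂ} (hx : energy x ≤ r * ρ) (hw : energy w ≤ r * ρ) :
    M *ᵥ x + w ∈ √ρ • sumset M r := by
  have hs : √ρ ≠ 0 := (Real.sqrt_pos.2 hρ).ne'
  have he : ∀ y : Fin n → ℂ, energy y ≤ r * ρ → energy ((√ρ)⁻¹ • y) ≤ r := fun y hy => by
    rw [energy_smul, inv_pow, Real.sq_sqrt hρ.le, inv_mul_le_iff₀ hρ]
    linarith
  refine Set.mem_smul_set.2 ⟨(√ρ)⁻¹ • (M *ᵥ x + w), ⟨_, _, he x hx, he w hw, ?_⟩,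
    smul_inv_smul₀ hs _⟩
  rw [smul_add, Matrix.mulVec_smul]

lemma received_zero {n : ℕ} (h : Fading 2 n) (F : Fin 2 → Matrix (Fin n) (Fin n) ℂ)
    (z x : Fin 2 → Fin n → ℂ) :
    received (h, F, z) x 0 = directMatrix h F 0 *ᵥ x 0 + h 0 1 * x 1 + z 0 := by
  funext j
  have : Finset.univ.erase (0 : Fin 2) = {1} := by decide
  simp only [received, this, Finset.sum_singleton, Pi.add_apply, Pi.mul_apply]
  ring

/-- Both receivers are made to see the same codeword `h 0 1 * x 1`: receiver 1 sees it through the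
direct matrix divided by the cross coefficients. -/
lemma received_one {n : ℕ} (h : Fading 2 n) (F : Fin 2 → Matrix (Fin n) (Fin n) ℂ)
    (z x : Fin 2 → Fin n → ℂ) (h0 : ∀ j, h 0 1 j ≠ 0) :
    received (h, F, z) x 1 =
      (directMatrix h F 1 * diagonal (h 0 1)⁻¹) *ᵥ (h 0 1 * x 1) + h 1 0 * x 0 + z 1 := by
  have hx : (directMatrix h F 1 * diagonal (h 0 1)⁻¹) *ᵥ (h 0 1 * x 1) =
      directMatrix h F 1 *ᵥ x 1 := by
    rw [← Matrix.mulVec_mulVec]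
    congr 1
    funext j
    rw [Matrix.mulVec_diagonal, Pi.mul_apply, Pi.inv_apply, inv_mul_cancel_left₀ (h0 j)]
  rw [hx]
  funext j
  have : Finset.univ.erase (1 : Fin 2) = {0} := by decide
  simp only [received, this, Finset.sum_singleton, Pi.add_apply, Pi.mul_apply]
  ring

lemma blockNoise_le_noisesLaw {K n : ℕ} (p : Fin K) {A : Set (Fin n → ℂ)}
    {B : Set (Fin K → Fin n → ℂ)} (hA : MeasurableSet A) (hAB : ∀ z, z p ∈ A → z ∈ B) :
    (blockNoise n).real A ≤ (noisesLaw K n).real B := by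
  refine ENNReal.toReal_mono (measure_ne_top _ _) ?_
  have hp := measurePreserving_eval (fun _ : Fin K => blockNoise n) p
  rw [← hp.measure_preimage hA.nullMeasurableSet]
  exact measure_mono hAB

lemma Code.HasPower.energy_le {K n : ℕ} {N : Fin K → ℕ} {c : Code K n N} {ρ : ℝ}
    (hpow : c.HasPower ρ) (hN : ∀ q, 0 < N q) (q : Fin K) (m : Fin (N q)) (θ : Fading K n) :
    energy (c.enc q m θ) ≤ n * ρ := by
  obtain ⟨m', rfl⟩ : ∃ m' : (q : Fin K) → Fin (N q), m' q = m :=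
    ⟨Function.update (fun q => ⟨0, hN q⟩) q m, Function.update_self ..⟩
  exact (Finset.single_le_sum (f := fun q => energy (c.enc q (m' q) θ))
    (fun _ _ => energy_nonneg _) (Finset.mem_univ q)).trans (hpow m' θ)

/-- The bound on the number of messages of a code for two users that is good for a given
realization of the channel. -/
lemma Code.card_messages_le {n : ℕ} {N : Fin 2 → ℕ} (c : Code 2 n N)
    (U : Fin 2 → Fin 2 → Finset (Fin n)) {h : Fading 2 n}
    {F : Fin 2 → Matrix (Fin n) (Fin n) ℂ} {ρ b R R₂ V W : ℝ} (hV : 0 ≤ V) (hW : 0 ≤ W)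
    (hρ : 1 ≤ ρ) (hN : ∀ q, 0 < N q) (hpow : c.HasPower ρ)
    (hh0 : ∀ j, h 0 1 j ≠ 0) (hhb : ∀ j, ‖h 0 1 j‖ ≤ b)
    (hR0 : 0 ≤ R) (hR : blockNoise n {z | R * n < energy z} ≤ 1 / 8) (hR1 : 1 ≤ R₂)
    (hR₂ : 2 * b ^ 2 + 2 * R ≤ R₂)
    (hVM : volume (sumset (directMatrix h F 1 * diagonal (h 0 1)⁻¹) (R * n)) ≤ ENNReal.ofReal V)
    (hWS : volume (√ρ • sumset (directMatrix h F 0) (R₂ * n)) ≤ ENNReal.ofReal W)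
    (herr : ∑ m, (noisesLaw 2 n).real {z | (h, F, z) ∈ c.errorEvent U m} ≤
      1 / 16 * ((N 0 : ℝ) * N 1)) :
    (N 0 * N 1 : ℝ) ≤ 6 * (V * W) := by
  have hρ0 : 0 < ρ := by linarith
  have hmeas : ∀ (p : Fin 2) (y : Fin n → ℂ) (m : Fin (N p)),
      MeasurableSet {z | c.dec p (y + z, knownCSI U h, directMatrix h F p) ≠ m} := fun p y m =>
    (measurableSet_eq_fun ((c.dec_measurable p).comp (by fun_prop)) measurable_const).compl
  refine InterferenceChannel.card_messages_le (n := n) (N₀ := N 0) (N₁ := N 1) (R := R) hV hW hR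
    (directMatrix h F 1 * diagonal (h 0 1)⁻¹) hVM
    (fun m => directMatrix h F 0 *ᵥ c.enc 0 m (knownCSI U h))
    (fun m => h 1 0 * c.enc 0 m (knownCSI U h)) (fun m => h 0 1 * c.enc 1 m (knownCSI U h))
    (√ρ • sumset (directMatrix h F 0) (R₂ * n)) hWS ?_
    (fun y => c.dec 0 (y, knownCSI U h, directMatrix h F 0))
    ((c.dec_measurable 0).comp (by fun_prop))
    (fun y => c.dec 1 (y, knownCSI U h, directMatrix h F 1))
    ((c.dec_measurable 1).comp (by fun_prop)) ?_ ?_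
  · intro m₀ m₁ z hz
    rw [add_assoc]
    -- Signal energies scale with `ρ`, and the noise energy is absorbed using `1 ≤ ρ`. Scaling by
    -- `√ρ` in real dimension `2 n` will cost the factor `ρ ^ n`.
    refine mem_smul_sumset _ hρ0 ?_ ?_
    · refine (hpow.energy_le hN 0 m₀ _).trans ?_
      have : (n : ℝ) ≤ R₂ * n := le_mul_of_one_le_left (by positivity) hR1
      gcongr
    · refine (energy_add_le _ _).trans ?_
      have h1 := energy_mul_le (h 0 1) (c.enc 1 m₁ (knownCSI U h)) hhb
      have h2 : b ^ 2 * energy (c.enc 1 m₁ (knownCSI U h)) ≤ b ^ 2 * (n * ρ) :=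
        mul_le_mul_of_nonneg_left (hpow.energy_le hN 1 m₁ _) (sq_nonneg b)
      have h4 : (2 * b ^ 2 + 2 * R) * (n * ρ) ≤ R₂ * (n * ρ) :=
        mul_le_mul_of_nonneg_right hR₂ (by positivity)
      have h5 : R * n * 1 ≤ R * n * ρ := mul_le_mul_of_nonneg_left hρ (by positivity)
      linarith
  · rw [← (piFinTwoEquiv fun q => Fin (N q)).sum_comp]
    refine (Finset.sum_le_sum fun m _ => ?_).trans herr
    refine blockNoise_le_noisesLaw 0 (hmeas 0 _ (m 0)) fun z hz => ⟨0, ?_⟩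
    rw [received_zero]
    exact hz
  · rw [← (piFinTwoEquiv fun q => Fin (N q)).sum_comp]
    refine (Finset.sum_le_sum fun m _ => ?_).trans herr
    refine blockNoise_le_noisesLaw 1 (hmeas 1 _ (m 1)) fun z hz => ⟨1, ?_⟩
    rw [received_one _ _ _ _ hh0]
    exact hz

/-- The number of messages of a good code for two users grows at most like `(C ρ) ^ n`. -/
lemma ChannelLaw.exists_card_messages_le (L : ChannelLaw) :
    ∃ C : ℝ, 1 ≤ C ∧ ∀ᶠ n : ℕ in atTop, ∀ (U : Fin 2 → Fin 2 → Finset (Fin n)) (ρ : ℝ)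
      (N : Fin 2 → ℕ) (c : Code 2 n N), 1 ≤ ρ → (∀ q, 0 < N q) → c.HasPower ρ →
      c.errorProb L U ≤ 1 / 64 → (N 0 * N 1 : ℝ) ≤ 6 * (C * ρ) ^ n := by
  obtain ⟨a, b, ha, hab⟩ := L.fading_bounded
  obtain ⟨R, hR0, hR⟩ := exists_blockNoise_energy_tail_le
  -- The factor `2` bounds the normalized trace of a typical `F p`; `b / a` bounds the ratios of
  -- fading coefficients, `b` the coefficients themselves.
  obtain ⟨C₁, hC₁1, hC₁⟩ := exists_volume_sumset_le R ((b / a) ^ 2 * 2)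
  obtain ⟨C₂, hC₂1, hC₂⟩ := exists_volume_sumset_le (max 1 (2 * b ^ 2 + 2 * R)) (b ^ 2 * 2)
  refine ⟨C₁ * C₂, by nlinarith, ?_⟩
  have hF : ∀ᶠ n : ℕ in atTop, ∀ p : Fin 2, L.direct p n
      {F | 1 ≤ |(F * F.conjTranspose).trace.re / n - 1|} ≤ 1 / 4 := by
    rw [eventually_all]
    exact fun p => (L.direct_trace p 1 one_pos).eventually (ge_mem_nhds (by norm_num))
  filter_upwards [hF, eventually_gt_atTop 0] with n hFn hn U ρ N c hρ hN hpow hc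
  have hρ0 : 0 < ρ := by linarith
  obtain ⟨h, F, hh, htr, herr⟩ := L.exists_good_realization c U hN hab hn hFn hc
  have hMF : directMatrix h F 1 * diagonal (h 0 1)⁻¹ = F 1 * diagonal (h 1 1 * (h 0 1)⁻¹) := by
    rw [directMatrix, Matrix.mul_assoc, Matrix.diagonal_mul_diagonal]; rfl
  have hdiag : ∀ j, ‖(h 1 1 * (h 0 1)⁻¹) j‖ ≤ b / a := fun j => by
    rw [Pi.mul_apply, Pi.inv_apply, norm_mul, norm_inv, ← div_eq_mul_inv]
    exact div_le_div₀ ((norm_nonneg _).trans (hh 1 1 j).2) (hh 1 1 j).2 ha (hh 0 1 j).1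
  have hV := hC₁ n _ (trace_mul_diagonal_le (F 1) _ hdiag (htr 1))
  rw [← hMF] at hV
  have hW := hC₂ n _ (trace_mul_diagonal_le (F 0) _ (fun j => (hh 0 0 j).2) (htr 0))
  have hS : volume (√ρ • sumset (directMatrix h F 0) (max 1 (2 * b ^ 2 + 2 * R) * n)) ≤
      ENNReal.ofReal (ρ ^ n * C₂ ^ n) := by
    rw [volume_smul, Real.sq_sqrt hρ0.le, ENNReal.ofReal_mul (by positivity)]
    exact mul_le_mul_right hW _
  calc (N 0 * N 1 : ℝ) ≤ 6 * (C₁ ^ n * (ρ ^ n * C₂ ^ n)) :=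
        c.card_messages_le U (by positivity) (by positivity) hρ hN hpow
          (fun j => norm_pos_iff.1 (ha.trans_le (hh 0 1 j).1)) (fun j => (hh 0 1 j).2) hR0.le
          (hR n) (le_max_left _ _) (le_max_right _ _) hV hS herr
    _ = 6 * (C₁ * C₂ * ρ) ^ n := by rw [mul_pow, mul_pow]; ring

/-- The converse for two users: their sum rate is at most `log ρ` up to a constant. -/
lemma ChannelLaw.exists_sum_rate_le (L : ChannelLaw) :
    ∃ C : ℝ, ∀ (U : CSIPattern 2) (ρ : ℝ), 1 ≤ ρ → ∀ R ∈ L.capacityRegion U ρ,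
      R 0 + R 1 ≤ Real.logb 2 ρ + C := by
  obtain ⟨C, hC1, hC⟩ := L.exists_card_messages_le
  refine ⟨Real.logb 2 (6 * C), fun U ρ hρ => ?_⟩
  have hρ0 : 0 < ρ := by linarith
  refine closure_minimal (t := {R : Fin 2 → ℝ | R 0 + R 1 ≤ Real.logb 2 ρ + Real.logb 2 (6 * C)})
    ?_ (isClosed_le (by fun_prop) continuous_const)
  rintro R ⟨-, hR⟩
  -- A single large block length suffices, as the constant is independent of `n`.
  obtain ⟨n, ⟨hCn, N, c, hN, hpow, herr⟩, hn⟩ :=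
    ((hC.and (hR (1 / 64) (by norm_num))).and (eventually_gt_atTop 0)).exists
  have hn' : (0 : ℝ) < n := by exact_mod_cast hn
  have hNpos : ∀ q, 0 < N q := fun q => by
    have := (Real.rpow_pos_of_pos two_pos _).trans_le (hN q)
    exact_mod_cast this
  have h1 := hCn (U n) ρ N c hρ hNpos hpow herr
  have h2 : (2 : ℝ) ^ (n * (R 0 + R 1)) ≤ (6 * C * ρ) ^ n := by
    rw [mul_add, Real.rpow_add two_pos]
    calc _ ≤ (N 0 * N 1 : ℝ) := mul_le_mul (hN 0) (hN 1) (by positivity) (by positivity)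
      _ ≤ 6 * (C * ρ) ^ n := h1
      _ ≤ 6 ^ n * (C * ρ) ^ n := by
        gcongr
        exact le_self_pow₀ (by norm_num) hn.ne'
      _ = _ := by rw [← mul_pow, mul_assoc]
  have h3 := Real.logb_le_logb_of_le one_lt_two (by positivity) h2
  rw [Real.logb_rpow two_pos (by norm_num), Real.logb_pow] at h3
  have h4 := le_of_mul_le_mul_left h3 hn'
  rw [Real.logb_mul (by positivity) (by positivity)] at h4
  change R 0 + R 1 ≤ _
  linarith

/-! ### Subsets of the users -/

lemma measurePreserving_pi_comp {ι ι' X : Type*} [Fintype ι] [Fintype ι'] [MeasurableSpace X]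
    (μ : ι → Measure X) [∀ i, IsProbabilityMeasure (μ i)] {e : ι' → ι}
    (he : Function.Injective e) :
    MeasurePreserving (fun (x : ι → X) (i : ι') => x (e i)) (Measure.pi μ)
      (Measure.pi fun i => μ (e i)) := by
  refine ⟨by fun_prop, (Measure.pi_eq fun t ht => ?_).symm⟩
  rw [Measure.map_apply (by fun_prop) (MeasurableSet.univ_pi ht)]
  have hpre : (fun (x : ι → X) (i : ι') => x (e i)) ⁻¹' Set.univ.pi t =
      Set.univ.pi (Function.extend e t fun _ => Set.univ) := by
    ext x
    simp only [Set.mem_preimage, Set.mem_univ_pi]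
    constructor
    · intro h i
      by_cases hi : ∃ i', e i' = i
      · obtain ⟨i', rfl⟩ := hi
        rw [he.extend_apply]
        exact h i'
      · rw [Function.extend_apply' _ _ _ hi]
        exact Set.mem_univ _
    · intro h i'
      have := h (e i')
      rwa [he.extend_apply] at this
  rw [hpre, Measure.pi_pi]
  refine (Fintype.prod_of_injective e he _ _ (fun i hi => ?_) fun i' => ?_).symm
  · rw [Function.extend_apply' _ _ _ hi, measure_univ]
  · rw [he.extend_apply]

lemma measurePreserving_pi_prod {ι X : Type*} [Fintype ι] [MeasurableSpace X]
    (μ : ι → Measure X) [∀ i, IsProbabilityMeasure (μ i)] (f : ι → X × X → X)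
    (hf : ∀ i, MeasurePreserving (f i) ((μ i).prod (μ i)) (μ i)) :
    MeasurePreserving (fun (w : (ι → X) × (ι → X)) (i : ι) => f i (w.1 i, w.2 i))
      ((Measure.pi μ).prod (Measure.pi μ)) (Measure.pi μ) :=
  (measurePreserving_pi (fun i => (μ i).prod (μ i)) μ hf).comp
    (measurePreserving_arrowProdEquivProdArrow X X ι μ μ).symm

/-- The channel law with renamed users. -/
def ChannelLaw.reindex (L : ChannelLaw) (σ : ℕ → ℕ) : ChannelLaw where
  fading := L.fading
  fading_prob := L.fading_prob
  fading_noAtoms := L.fading_noAtoms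
  fading_bounded := L.fading_bounded
  fading_secondMoment := L.fading_secondMoment
  direct p n := L.direct (σ p) n
  direct_prob p n := L.direct_prob (σ p) n
  direct_fullRank p n := L.direct_fullRank (σ p) n
  direct_trace p := L.direct_trace (σ p)

variable {K K' n : ℕ}

/-- The part of the channel state that concerns the users in the range of `e`. -/
def restrictState (e : Fin K' → Fin K) (s : ChannelState K n) : ChannelState K' n :=
  (fun p q => s.1 (e p) (e q), fun p => s.2.1 (e p), fun p => s.2.2 (e p))

lemma measurePreserving_restrictState (L : ChannelLaw) {e : Fin K' → Fin K}
    (he : Function.Injective e) {σ : ℕ → ℕ} (hσ : ∀ p : Fin K', σ p = e p) :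
    MeasurePreserving (restrictState (n := n) e) (L.stateLaw K n)
      ((L.reindex σ).stateLaw K' n) := by
  have h1 : MeasurePreserving (fun (h : Fading K n) (p q : Fin K') => h (e p) (e q))
      (L.fadingLaw K n) ((L.reindex σ).fadingLaw K' n) :=
    (measurePreserving_pi _ _ fun _ : Fin K' => measurePreserving_pi_comp
      (fun _ : Fin K => Measure.pi fun _ : Fin n => L.fading) he).comp
      (measurePreserving_pi_comp (fun _ : Fin K => Measure.pi fun _ : Fin K =>
        Measure.pi fun _ : Fin n => L.fading) he)
  have h2 : MeasurePreserving
      (fun (F : Fin K → Matrix (Fin n) (Fin n) ℂ) (p : Fin K') => F (e p))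
      (L.directLaw K n) ((L.reindex σ).directLaw K' n) := by
    have := measurePreserving_pi_comp (fun p : Fin K => L.direct p n) he
    simpa only [ChannelLaw.directLaw, ChannelLaw.reindex, hσ] using this
  have h3 : MeasurePreserving (fun (z : Fin K → Fin n → ℂ) (p : Fin K') => z (e p))
      (noisesLaw K n) (noisesLaw K' n) :=
    measurePreserving_pi_comp (fun _ : Fin K => blockNoise n) he
  exact h1.prod (h2.prod h3)

/-- The array with the entries of `θ` at the pairs of users in the range of `e`, and with those of
`g` elsewhere. -/
def combine (e : Fin K' → Fin K) (θ : Fading K' n) (g : Fading K n) : Fading K n := fun p q =>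
  Function.extend (Prod.map e e) (fun i => θ i.1 i.2) (fun i => g i.1 i.2) (p, q)

lemma combine_apply {e : Fin K' → Fin K} (he : Function.Injective e) (θ : Fading K' n)
    (g : Fading K n) (p q : Fin K') : combine e θ g (e p) (e q) = θ p q :=
  (he.prodMap he).extend_apply _ _ (p, q)

lemma combine_apply' {e : Fin K' → Fin K} (θ : Fading K' n) (g : Fading K n) {p q : Fin K}
    (hpq : ¬ (p ∈ Set.range e ∧ q ∈ Set.range e)) : combine e θ g p q = g p q := by
  refine Function.extend_apply' _ _ _ ?_
  rintro ⟨⟨p', q'⟩, h⟩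
  exact hpq ⟨⟨p', (Prod.ext_iff.1 h).1⟩, ⟨q', (Prod.ext_iff.1 h).2⟩⟩

lemma measurable_combine {e : Fin K' → Fin K} (he : Function.Injective e) (g : Fading K n) :
    Measurable fun θ : Fading K' n => combine e θ g := by
  refine measurable_fading_iff.2 fun p q j => ?_
  by_cases h : p ∈ Set.range e ∧ q ∈ Set.range e
  · obtain ⟨⟨p', rfl⟩, ⟨q', rfl⟩⟩ := h
    simp only [combine_apply he]
    fun_prop
  · simp only [combine_apply' _ _ h]
    fun_prop

lemma knownCSI_combine {e : Fin K' → Fin K} (he : Function.Injective e)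
    (U : Fin K → Fin K → Finset (Fin n)) (θ : Fading K' n) (g : Fading K n) :
    knownCSI U (combine e θ g) =
      combine e (knownCSI (fun p q => U (e p) (e q)) θ) (knownCSI U g) := by
  funext p q j
  by_cases h : p ∈ Set.range e ∧ q ∈ Set.range e
  · obtain ⟨⟨p', rfl⟩, ⟨q', rfl⟩⟩ := h
    simp only [combine_apply he, knownCSI]
  · simp only [combine_apply' _ _ h, knownCSI]

/-- Redrawing the coefficients of the links that involve the users outside the range of `e`
preserves the law of the channel state. -/
lemma measurePreserving_combine (L : ChannelLaw) {e : Fin K' → Fin K}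
    (he : Function.Injective e) :
    MeasurePreserving (fun w : ChannelState K n × Fading K n =>
      ((combine e (restrictState e w.1).1 w.2, w.1.2) : ChannelState K n))
      ((L.stateLaw K n).prod (L.fadingLaw K n)) (L.stateLaw K n) := by
  classical
  -- Each link is taken from one of two independent copies, by a rule that depends only on its
  -- indices.
  set f : Fin K → Fin K → (Fin n → ℂ) × (Fin n → ℂ) → Fin n → ℂ := fun p q =>
    if p ∈ Set.range e ∧ q ∈ Set.range e then Prod.fst else Prod.snd with hf
  have h1 : MeasurePreserving (fun (w : Fading K n × Fading K n) (p q : Fin K) =>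
      f p q (w.1 p q, w.2 p q)) ((L.fadingLaw K n).prod (L.fadingLaw K n))
      (L.fadingLaw K n) := by
    refine measurePreserving_pi_prod
      (fun _ => Measure.pi fun _ : Fin K => Measure.pi fun _ : Fin n => L.fading)
      (fun p w q => f p q (w.1 q, w.2 q)) fun p => ?_
    refine measurePreserving_pi_prod (fun _ : Fin K => Measure.pi fun _ : Fin n => L.fading)
      (fun q => f p q) fun q => ?_
    rw [hf]
    dsimp only
    split_ifs
    · exact measurePreserving_fst
    · exact measurePreserving_snd
  have h2 : (fun w : ChannelState K n × Fading K n =>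
      ((combine e (restrictState e w.1).1 w.2, w.1.2) : ChannelState K n)) =
      (fun w : (Fading K n × Fading K n) × ((Fin K → Matrix (Fin n) (Fin n) ℂ) ×
        (Fin K → Fin n → ℂ)) => (fun p q => f p q (w.1.1 p q, w.1.2 p q), w.2)) ∘
      (fun w => ((w.1.1, w.2), w.1.2)) := by
    funext w
    refine Prod.ext ?_ rfl
    funext p q
    dsimp only [Function.comp]
    by_cases h : p ∈ Set.range e ∧ q ∈ Set.range e
    · rw [show f p q = Prod.fst from if_pos h]
      obtain ⟨⟨p', rfl⟩, ⟨q', rfl⟩⟩ := h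
      rw [combine_apply he]; rfl
    · rw [show f p q = Prod.snd from if_neg h, combine_apply' _ _ h]
  rw [h2, L.stateLaw_eq]
  refine (h1.prod (MeasurePreserving.id _)).comp ?_
  set ν := (L.directLaw K n).prod (noisesLaw K n)
  set μ := L.fadingLaw K n
  have h3 : MeasurePreserving MeasurableEquiv.prodAssoc ((μ.prod ν).prod μ)
      (μ.prod (ν.prod μ)) := measurePreserving_prodAssoc μ ν μ
  have h4 : MeasurePreserving (Prod.map id Prod.swap) (μ.prod (ν.prod μ)) (μ.prod (μ.prod ν)) :=
    (MeasurePreserving.id μ).prod Measure.measurePreserving_swap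
  have h5 : MeasurePreserving MeasurableEquiv.prodAssoc.symm (μ.prod (μ.prod ν))
      ((μ.prod μ).prod ν) := (measurePreserving_prodAssoc μ μ ν).symm
  exact h5.comp (h4.comp h3)

open scoped Classical in
lemma sum_erase_apply {e : Fin K' → Fin K} (he : Function.Injective e) (f : Fin K → ℂ)
    (p : Fin K') :
    ∑ q ∈ Finset.univ.erase (e p), f q =
      ∑ q ∈ Finset.univ.erase p, f (e q) + ∑ q : {q // q ∉ Set.range e}, f q := by
  have h1 : ∑ q, f q = ∑ q, f (e q) + ∑ q : {q // q ∉ Set.range e}, f q := by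
    rw [← Fintype.sum_subtype_add_sum_subtype (fun q => q ∈ Set.range e) f]
    congr 1
    convert! (Fintype.sum_equiv (Equiv.ofInjective e he) (fun q => f (e q)) (fun q => f q.1)
      fun _ => rfl).symm
  rw [Finset.sum_erase_eq_sub (Finset.mem_univ _), Finset.sum_erase_eq_sub (Finset.mem_univ _), h1]
  ring

/-- A family of messages is a family of messages for the users in the range of `e`, together with
one for the other users. -/
lemma exists_messagesEquiv {e : Fin K' → Fin K} (he : Function.Injective e) (N : Fin K → ℕ) :
    ∃ E : ((q : Fin K) → Fin (N q)) ≃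
        ((p : Fin K') → Fin (N (e p))) × ((q : {q // q ∉ Set.range e}) → Fin (N q)),
      ∀ m, E m = (fun p => m (e p), fun (q : {q // q ∉ Set.range e}) => m q.1) := by
  refine ⟨Equiv.ofBijective (fun m => (fun p => m (e p),
    fun (q : {q // q ∉ Set.range e}) => m q.1)) ⟨?_, ?_⟩, fun m => rfl⟩
  · intro m m' h
    funext q
    by_cases hq : q ∈ Set.range e
    · obtain ⟨p, rfl⟩ := hq
      exact congrFun (Prod.ext_iff.1 h).1 p
    · exact congrFun (Prod.ext_iff.1 h).2 ⟨q, hq⟩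
  · rintro ⟨m', r⟩
    have hex : ∀ q, ∃ x : Fin (N q), (∀ p (h : e p = q), x = h ▸ m' p) ∧
        ∀ h : q ∉ Set.range e, x = r ⟨q, h⟩ := fun q => by
      by_cases hq : q ∈ Set.range e
      · obtain ⟨p, rfl⟩ := hq
        refine ⟨m' p, fun p' h => ?_, fun h => (h ⟨p, rfl⟩).elim⟩
        obtain rfl := he h
        rfl
      · exact ⟨r ⟨q, hq⟩, fun p h => (hq ⟨p, h⟩).elim, fun _ => rfl⟩
    choose x hx1 hx2 using hex
    exact ⟨x, Prod.ext (funext fun p => hx1 (e p) p rfl) (funext fun q => hx2 q q.2)⟩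

open scoped Classical in
/-- The code for the users in the range of `e`, when the messages of the other users and the
coefficients of all links that involve them are fixed. -/
def Code.restrict {N : Fin K → ℕ} (c : Code K n N) (U : Fin K → Fin K → Finset (Fin n))
    {e : Fin K' → Fin K} (he : Function.Injective e)
    (r : (q : {q // q ∉ Set.range e}) → Fin (N q)) (g : Fading K n) :
    Code K' n (fun p => N (e p)) where
  enc q m θ := c.enc (e q) m (combine e θ (knownCSI U g))
  dec p y := c.dec (e p)
    -- The absent interference is computable at the receiver, since the other messages and their
    -- links are fixed; adding it restores the block of the full channel.
    (fun j => y.1 j + ∑ q : {q // q ∉ Set.range e},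
      g (e p) q j * c.enc q (r q) (combine e y.2.1 (knownCSI U g)) j,
      combine e y.2.1 (knownCSI U g), y.2.2)
  enc_measurable q m := (c.enc_measurable (e q) m).comp (measurable_combine he _)
  dec_measurable p := by
    have hk : Measurable fun y : (Fin n → ℂ) × Fading K' n × Matrix (Fin n) (Fin n) ℂ =>
        combine e y.2.1 (knownCSI U g) :=
      (measurable_combine he _).comp (measurable_fst.comp measurable_snd)
    refine (c.dec_measurable (e p)).comp (Measurable.prodMk ?_
      (hk.prodMk (measurable_snd.comp measurable_snd)))
    refine measurable_pi_iff.2 fun j => Measurable.add (by fun_prop) ?_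
    refine Finset.measurable_fun_sum _ fun q _ => Measurable.const_mul ?_ _
    exact (measurable_pi_apply j).comp ((c.enc_measurable q (r q)).comp hk)

lemma Code.HasPower.restrict {N : Fin K → ℕ} {c : Code K n N} {ρ : ℝ} (hpow : c.HasPower ρ)
    (U : Fin K → Fin K → Finset (Fin n)) {e : Fin K' → Fin K} (he : Function.Injective e)
    (r : (q : {q // q ∉ Set.range e}) → Fin (N q)) (g : Fading K n) :
    (c.restrict U he r g).HasPower ρ := by
  intro m θ
  obtain ⟨E, hE⟩ := exists_messagesEquiv he N
  obtain ⟨m', hm'⟩ := E.surjective (m, r)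
  rw [hE] at hm'
  obtain rfl := (Prod.ext_iff.1 hm').1
  refine le_trans ?_ (hpow m' (combine e θ (knownCSI U g)))
  change ∑ q, energy (c.enc (e q) (m' (e q)) (combine e θ (knownCSI U g))) ≤
    ∑ q, energy (c.enc q (m' q) (combine e θ (knownCSI U g)))
  rw [← Finset.sum_image (s := Finset.univ) (g := e)
    (f := fun q => energy (c.enc q (m' q) (combine e θ (knownCSI U g)))) he.injOn]
  exact Finset.sum_le_sum_of_subset_of_nonneg (Finset.subset_univ _) fun _ _ _ => energy_nonneg _

lemma Code.mem_errorEvent_of_restrict {N : Fin K → ℕ} (c : Code K n N)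
    (U : Fin K → Fin K → Finset (Fin n)) {e : Fin K' → Fin K} (he : Function.Injective e)
    (m : (q : Fin K) → Fin (N q)) (g : Fading K n) (s : ChannelState K n)
    (hs : restrictState e s ∈ (c.restrict U he (fun q => m q.1) g).errorEvent
      (fun p q => U (e p) (e q)) (fun p => m (e p))) :
    ((combine e (restrictState e s).1 g, s.2) : ChannelState K n) ∈ c.errorEvent U m := by
  obtain ⟨p, hp⟩ := hs
  refine ⟨e p, fun h => hp (Eq.trans ?_ h)⟩
  dsimp only [Code.restrict]
  rw [← knownCSI_combine he U]
  have hd : directMatrix (restrictState e s).1 (restrictState e s).2.1 p =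
      directMatrix (combine e (restrictState e s).1 g) s.2.1 (e p) := by
    rw [directMatrix, directMatrix, combine_apply he]; rfl
  congr 1
  refine Prod.ext ?_ (Prod.ext rfl hd)
  funext j
  dsimp only [received]
  rw [sum_erase_apply he, hd]
  have h1 : ∀ q : {q // q ∉ Set.range e},
      combine e (restrictState e s).1 g (e p) q = g (e p) q := fun q =>
    combine_apply' _ _ fun h => q.2 h.2
  simp only [h1, combine_apply he]
  have h2 : (restrictState e s).2.2 p j = s.2.2 (e p) j := rfl
  rw [h2]
  ring

lemma Code.stateLaw_errorEvent_restrict_le {N : Fin K → ℕ} (L : ChannelLaw) (c : Code K n N)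
    (U : Fin K → Fin K → Finset (Fin n)) {e : Fin K' → Fin K} (he : Function.Injective e)
    {σ : ℕ → ℕ} (hσ : ∀ p : Fin K', σ p = e p) (m : (q : Fin K) → Fin (N q)) (g : Fading K n) :
    (L.reindex σ).stateLaw K' n ((c.restrict U he (fun q => m q.1) g).errorEvent
      (fun p q => U (e p) (e q)) (fun p => m (e p))) ≤
    L.stateLaw K n {s | ((combine e (restrictState e s).1 g, s.2) : ChannelState K n) ∈
      c.errorEvent U m} := by
  have hm := Code.measurableSet_errorEvent (c.restrict U he (fun q => m q.1) g)
    (fun p q => U (e p) (e q)) (fun p => m (e p))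
  rw [← (measurePreserving_restrictState L he hσ).measure_preimage hm.nullMeasurableSet]
  exact measure_mono fun s hs => c.mem_errorEvent_of_restrict U he m g s hs

/-- Some of the users of an interference channel do at least as well alone. -/
lemma Code.exists_restrict {N : Fin K → ℕ} (L : ChannelLaw) (c : Code K n N)
    (U : Fin K → Fin K → Finset (Fin n)) {ρ : ℝ} (hN : ∀ q, 0 < N q) (hpow : c.HasPower ρ)
    {e : Fin K' → Fin K} (he : Function.Injective e) {σ : ℕ → ℕ}
    (hσ : ∀ p : Fin K', σ p = e p) :
    ∃ c' : Code K' n (fun p => N (e p)), c'.HasPower ρ ∧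
      c'.errorProb (L.reindex σ) (fun p q => U (e p) (e q)) ≤ c.errorProb L U := by
  classical
  obtain ⟨E, hE⟩ := exists_messagesEquiv he N
  have : ∀ q, Nonempty (Fin (N q)) := fun q => ⟨⟨0, hN q⟩⟩
  set T : ((q : Fin K) → Fin (N q)) → Fading K n → ENNReal := fun m g =>
    L.stateLaw K n {s | ((combine e (restrictState e s).1 g, s.2) : ChannelState K n) ∈
      c.errorEvent U m} with hT
  have hΨ := measurePreserving_combine (n := n) L he
  have hTm : ∀ m, Measurable (T m) := fun m =>
    measurable_measure_prodMk_right (hΨ.measurable (c.measurableSet_errorEvent U m))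
  have hTint : ∀ m, ∫⁻ g, T m g ∂(L.fadingLaw K n) = L.stateLaw K n (c.errorEvent U m) :=
    fun m => by
      have hms := c.measurableSet_errorEvent U m
      rw [← hΨ.measure_preimage hms.nullMeasurableSet, Measure.prod_apply_symm (hΨ.measurable hms)]
      rfl
  set A : ((q : {q // q ∉ Set.range e}) → Fin (N q)) → ENNReal := fun r =>
    ∑ m', L.stateLaw K n (c.errorEvent U (E.symm (m', r))) with hA
  -- Averaging over the messages of the removed users: some choice is no worse than the mean.
  obtain ⟨r, hr⟩ : ∃ r, (∏ q : {q // q ∉ Set.range e}, (N q : ℝ)) * (A r).toReal ≤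
      ∑ m, (L.stateLaw K n).real (c.errorEvent U m) := by
    have hsum : ∑ r, (A r).toReal = ∑ m, (L.stateLaw K n).real (c.errorEvent U m) := by
      rw [← E.symm.sum_comp, Fintype.sum_prod_type_right]
      exact Finset.sum_congr rfl fun r _ => ENNReal.toReal_sum fun _ _ => measure_ne_top _ _
    by_contra! hcon
    have := Finset.sum_lt_sum_of_nonempty Finset.univ_nonempty fun r _ => hcon r
    rw [← Finset.mul_sum, hsum, Finset.sum_const, nsmul_eq_mul, Finset.card_univ,
      Fintype.card_pi] at this
    simp at this
  have hint : ∫⁻ g, ∑ m', T (E.symm (m', r)) g ∂(L.fadingLaw K n) = A r := by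
    rw [lintegral_finsetSum _ fun m' _ => hTm _]
    exact Finset.sum_congr rfl fun m' _ => hTint _
  -- Averaging over the redrawn coefficients, simultaneously for all messages of the remaining
  -- users.
  obtain ⟨g, hg⟩ := exists_le_lintegral (μ := L.fadingLaw K n)
    (f := fun g => ∑ m', T (E.symm (m', r)) g)
    (Finset.measurable_fun_sum _ fun m' _ => hTm _).aemeasurable
  rw [hint] at hg
  refine ⟨c.restrict U he r g, hpow.restrict U he r g, ?_⟩
  have hle : ∀ m', ((L.reindex σ).stateLaw K' n)
      ((c.restrict U he r g).errorEvent (fun p q => U (e p) (e q)) m') ≤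
      T (E.symm (m', r)) g := fun m' => by
    have h0 := c.stateLaw_errorEvent_restrict_le L U he hσ (E.symm (m', r)) g
    have h1 := E.apply_symm_apply (m', r)
    rw [hE] at h1
    obtain ⟨h2, h3⟩ := Prod.ext_iff.1 h1
    dsimp only at h2 h3
    rw [h2, h3] at h0
    exact h0
  have hA_top : A r ≠ ⊤ := (ENNReal.sum_lt_top.2 fun _ _ => measure_lt_top _ _).ne
  have hreal : ∑ m', ((L.reindex σ).stateLaw K' n).real
      ((c.restrict U he r g).errorEvent (fun p q => U (e p) (e q)) m') ≤ (A r).toReal := by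
    have h1 := ENNReal.toReal_mono hA_top ((Finset.sum_le_sum fun m' _ => hle m').trans hg)
    rwa [ENNReal.toReal_sum fun _ _ => measure_ne_top _ _] at h1
  have hprod : ∏ q, (N q : ℝ) =
      (∏ p, (N (e p) : ℝ)) * ∏ q : {q // q ∉ Set.range e}, (N q : ℝ) := by
    have h1 := Fintype.card_congr E
    rw [Fintype.card_prod, Fintype.card_pi, Fintype.card_pi, Fintype.card_pi] at h1
    simp only [Fintype.card_fin] at h1
    exact_mod_cast h1
  have hpos : ∀ q, (0 : ℝ) < N q := fun q => by exact_mod_cast hN q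
  have hP1 : 0 < ∏ p, (N (e p) : ℝ) := Finset.prod_pos fun p _ => hpos _
  have hP2 : 0 < ∏ q : {q // q ∉ Set.range e}, (N q : ℝ) := Finset.prod_pos fun p _ => hpos _
  rw [Code.errorProb, Code.errorProb, hprod, div_le_div_iff₀ hP1 (by positivity)]
  calc _ ≤ (A r).toReal * ((∏ p, (N (e p) : ℝ)) * ∏ q : {q // q ∉ Set.range e}, (N q : ℝ)) := by
        gcongr
    _ = ((∏ q : {q // q ∉ Set.range e}, (N q : ℝ)) * (A r).toReal) * ∏ p, (N (e p) : ℝ) := by ring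
    _ ≤ _ := by gcongr

lemma ChannelLaw.mem_capacityRegion_restrict (L : ChannelLaw) {U : CSIPattern K} {ρ : ℝ}
    {R : Fin K → ℝ} (hR : R ∈ L.capacityRegion U ρ) {e : Fin K' → Fin K}
    (he : Function.Injective e) {σ : ℕ → ℕ} (hσ : ∀ p : Fin K', σ p = e p) :
    (fun p => R (e p)) ∈ (L.reindex σ).capacityRegion (fun n p q => U n (e p) (e q)) ρ := by
  refine map_mem_closure (f := fun (R : Fin K → ℝ) (p : Fin K') => R (e p)) (by fun_prop) hR ?_
  rintro R ⟨hR0, hR⟩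
  refine ⟨fun p => hR0 (e p), fun ε hε => (hR ε hε).mono ?_⟩
  rintro n ⟨N, c, hN, hpow, herr⟩
  have hNpos : ∀ q, 0 < N q := fun q => by
    have := (Real.rpow_pos_of_pos two_pos _).trans_le (hN q)
    exact_mod_cast this
  obtain ⟨c', hc', herr'⟩ := c.exists_restrict L (U n) hNpos hpow he hσ
  exact ⟨_, c', fun p => hN (e p), hc', herr'.trans herr⟩

/-! ### The degrees of freedom region -/

lemma ChannelLaw.mem_dofRegion_of_le (L : ChannelLaw) {U : CSIPattern K} {d d' : Fin K → ℝ}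
    (hd : d ∈ L.dofRegion U) (hd0 : ∀ q, 0 ≤ d' q) (hle : ∀ q, d' q ≤ d q) :
    d' ∈ L.dofRegion U :=
  ⟨hd0, fun w hw => le_trans (EReal.coe_le_coe_iff.2 (Finset.sum_le_sum fun q _ =>
    mul_le_mul_of_nonneg_left (hle q) (hw q))) (hd.2 w hw)⟩

/-- Weights on the subset of users extend by zero, so the weighted rate ignores the removed users,
and the remaining rates stay in the smaller capacity region. -/
lemma ChannelLaw.mem_dofRegion_restrict (L : ChannelLaw) {U : CSIPattern K} {d : Fin K → ℝ}
    (hd : d ∈ L.dofRegion U) {e : Fin K' → Fin K} (he : Function.Injective e) {σ : ℕ → ℕ}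
    (hσ : ∀ p : Fin K', σ p = e p) :
    (fun p => d (e p)) ∈ (L.reindex σ).dofRegion (fun n p q => U n (e p) (e q)) := by
  refine ⟨fun p => hd.1 (e p), fun w hw => ?_⟩
  have hsum : ∀ x : Fin K → ℝ, ∑ q, Function.extend e w 0 q * x q = ∑ p, w p * x (e p) :=
    fun x => by
      refine (Fintype.sum_of_injective e he _ _ (fun q hq => ?_) fun p => ?_).symm
      · rw [Function.extend_apply' _ _ _ hq, Pi.zero_apply, zero_mul]
      · rw [he.extend_apply]
  have hw0 : ∀ q, 0 ≤ Function.extend e w 0 q := fun q => by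
    by_cases hq : ∃ p, e p = q
    · obtain ⟨p, rfl⟩ := hq
      rw [he.extend_apply]
      exact hw p
    · rw [Function.extend_apply' _ _ _ hq, Pi.zero_apply]
  have h := hd.2 _ hw0
  simp only [hsum] at h
  refine h.trans (limsup_le_limsup (Eventually.of_forall fun ρ => ?_))
  refine iSup₂_le fun R hR => ?_
  exact le_iSup₂_of_le (fun p => R (e p)) (L.mem_capacityRegion_restrict hR he hσ) le_rfl

/-- With unit weights, the normalized sum rate is at most `1 + C / log₂ ρ`, which tends to `1`. -/
lemma ChannelLaw.dof_two_users_le_one (L : ChannelLaw) {U : CSIPattern 2} {d : Fin 2 → ℝ}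
    (hd : d ∈ L.dofRegion U) : d 0 + d 1 ≤ 1 := by
  obtain ⟨C, hC⟩ := L.exists_sum_rate_le
  have h := hd.2 (fun _ => 1) fun _ => zero_le_one
  simp only [one_mul, Fin.sum_univ_two] at h
  have hlim : Tendsto (fun ρ : ℝ => ((1 + C / Real.logb 2 ρ : ℝ) : EReal)) atTop (𝓝 (1 : ℝ)) := by
    refine (continuous_coe_real_ereal.tendsto _).comp ?_
    simpa using ((Real.tendsto_logb_atTop one_lt_two).const_div_atTop C).const_add 1
  rw [← EReal.coe_le_coe_iff]
  refine h.trans (le_trans (limsup_le_limsup ?_) hlim.limsup_eq.le)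
  filter_upwards [eventually_gt_atTop 1] with ρ hρ
  refine iSup₂_le fun R hR => EReal.coe_le_coe_iff.2 ?_
  have hlog : 0 < Real.logb 2 ρ := Real.logb_pos one_lt_two hρ
  rw [div_le_iff₀ hlog, add_mul, div_mul_cancel₀ _ hlog.ne', one_mul]
  exact hC U ρ hρ.le R hR

lemma ChannelLaw.dof_add_dof_le_one (L : ChannelLaw) {U : CSIPattern K} {d : Fin K → ℝ}
    (hd : d ∈ L.dofRegion U) {p q : Fin K} (hpq : p ≠ q) : d p + d q ≤ 1 := by
  have he : Function.Injective ![p, q] := by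
    intro i j hij
    fin_cases i <;> fin_cases j <;> simp_all
  have hσ : ∀ i : Fin 2, (fun i => if i = 0 then (p : ℕ) else q) (i : ℕ) = (![p, q] i : Fin K) := by
    intro i
    fin_cases i <;> simp
  exact (L.reindex _).dof_two_users_le_one (L.mem_dofRegion_restrict hd he
    (σ := fun i => if i = 0 then (p : ℕ) else q) hσ)

/-! ### Adding a user and comparing sufficient fractions -/

/-- The pattern for `K + 1` users with perfect knowledge of all the links of the last user. -/
def CSIPattern.extend (V : CSIPattern K) : CSIPattern (K + 1) := fun n p q =>
  if h : (p : ℕ) < K ∧ (q : ℕ) < K then V n ⟨p, h.1⟩ ⟨q, h.2⟩ else ∅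

lemma CSIPattern.extend_castSucc (V : CSIPattern K) (n : ℕ) (p q : Fin K) :
    V.extend n p.castSucc q.castSucc = V n p q :=
  dif_pos ⟨p.2, q.2⟩

/-- Links of the new user contribute no unknown slot, so the union over cross links is the same. -/
lemma perfectFraction_extend (V : CSIPattern K) (n : ℕ) :
    perfectFraction V.extend n = perfectFraction V n := by
  unfold perfectFraction
  congr 4
  ext j
  simp only [Finset.mem_filter_univ]
  constructor
  · rintro ⟨p, q, hpq, hj⟩
    unfold CSIPattern.extend at hj
    split_ifs at hj with h
    · exact ⟨_, _, fun heq => hpq (Fin.ext (Fin.mk.inj_iff.1 heq)), hj⟩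
    · simp at hj
  · rintro ⟨p, q, hpq, hj⟩
    exact ⟨p.castSucc, q.castSucc, fun h => hpq (Fin.castSucc_injective K h),
      by rwa [V.extend_castSucc]⟩

lemma ChannelLaw.AchievesMaxDoF.of_extend {L : ChannelLaw} (hK : 2 ≤ K) {V : CSIPattern K}
    (h : L.AchievesMaxDoF V.extend) : L.AchievesMaxDoF V := by
  obtain ⟨d, hd, hsum⟩ := h
  have hK' : (2 : ℝ) ≤ K := by exact_mod_cast hK
  have hrestr : (fun p : Fin K => d p.castSucc) ∈ L.dofRegion V := by
    have := L.mem_dofRegion_restrict hd (Fin.castSucc_injective K) (σ := id) fun _ => rfl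
    simp only [V.extend_castSucc] at this
    exact this
  rw [Fin.sum_univ_castSucc] at hsum
  push_cast at hsum
  set S := ∑ p : Fin K, d p.castSucc with hS
  have hpair : S + K * d (Fin.last K) ≤ K := by
    have h1 : ∑ p : Fin K, (d p.castSucc + d (Fin.last K)) ≤ ∑ _p : Fin K, (1 : ℝ) :=
      Finset.sum_le_sum fun p _ => L.dof_add_dof_le_one hd (Fin.castSucc_lt_last p).ne
    simpa [Finset.sum_add_distrib] using h1
  -- Subtracting the total `S + d (Fin.last K) = (K + 1) / 2` from `hpair` leaves `(K - 1) * d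
  -- (Fin.last K) ≤ (K - 1) / 2`; dividing requires `K > 1`.
  have hlast : d (Fin.last K) ≤ 1 / 2 := by
    by_contra! hcon
    nlinarith
  have hSK : (K : ℝ) / 2 ≤ S := by linarith
  have hS0 : 0 < S := by linarith
  refine ⟨fun p => (K / 2 / S) * d p.castSucc, L.mem_dofRegion_of_le hrestr
    (fun p => mul_nonneg (by positivity) (hd.1 _)) (fun p => ?_), ?_⟩
  · exact mul_le_of_le_one_left (hd.1 _) ((div_le_one hS0).2 hSK)
  · rw [← Finset.mul_sum, ← hS, div_mul_cancel₀ _ hS0.ne']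

lemma ChannelLaw.sufficientFractions_succ_subset (L : ChannelLaw) (hK : 2 ≤ K) :
    L.sufficientFractions (K + 1) ⊆ L.sufficientFractions K := by
  rintro υ ⟨hυ, h⟩
  refine ⟨hυ, fun V hV => ChannelLaw.AchievesMaxDoF.of_extend hK (h V.extend ?_)⟩
  exact hV.congr fun n => (perfectFraction_extend V n).symm

end InterferenceChannel

end

theorem theorem5 (L : InterferenceChannel.ChannelLaw) (K : ℕ) (hK : 3 ≤ K) :
    L.minCSIFraction K ≥ L.minCSIFraction (K - 1) := by
  obtain ⟨k, rfl⟩ : ∃ k, K = k + 1 := ⟨K - 1, by omega⟩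
  exact sInf_le_sInf (Set.image_mono (L.sufficientFractions_succ_subset (by omega)))
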